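/- Let $(M,g)$ and $(N,h)$ be finite-dimensional smooth Riemannian manifolds without boundary, let $\phi\colon M\to N$ be a smooth map, let $X$ be a smooth Killing vector field on $N$, that is, $\langle\nabla_YX,Z\rangle+\langle\nabla_ZX,Y\rangle=0$ for all vector fields $Y,Z$ on $N$, and let $s\ge 1$ be an integer. Let $\bar\nabla$ be the connection on $\phi^*TN$ induced by the Levi-Civita connection $\nabla$ of $N$, let $\bar\Delta=-\operatorname{Tr}_g(\bar\nabla\bar\nabla-\bar\nabla_{\nabla})$ be the rough Laplacian on sections of $\phi^*TN$, let $\tau(\phi)=\operatorname{Tr}_g\bar\nabla d\phi$ be the tension field, and let $R^N(Y,Z)W=\nabla_Y\nabla_ZW-\nabla_Z\nabla_YW-\nabla_{[Y,Z]}W$. With a local orthonormal frame $\{e_j\}$ of $TM$ and summation over $j$, set \begin{align*} \tau_{2s+1}(\phi)={}&\bar\Delta^{2s}\tau(\phi)-R^N(\bar\Delta^{2s-1}\tau(\phi),d\phi(e_j))d\phi(e_j)\\ &-\sum_{\ell=1}^{s-1}\Big(R^N(\bar\nabla_{e_j}\bar\Delta^{s+\ell-1}\tau(\phi),\bar\Delta^{s-\ell-1}\tau(\phi))d\phi(e_j)\\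 &\qquad\quad-R^N(\bar\Delta^{s+\ell-1}\tau(\phi),\bar\nabla_{e_j}\bar\Delta^{s-\ell-1}\tau(\phi))d\phi(e_j)\Big)\\ &-R^N(\bar\nabla_{e_j}\bar\Delta^{s-1}\tau(\phi),\bar\Delta^{s-1}\tau(\phi))d\phi(e_j), \end{align*} and call $\phi$ polyharmonic of order $2s+1$ if $\tau_{2s+1}(\phi)=0$. Let $J^{2s+1}(\phi)$ be the vector field on $M$ dual with respect to $g$ to the one-form \begin{align*} v\mapsto{}&\langle\bar\nabla_v\bar\Delta^{2s-1}\tau(\phi),X\circ\phi\rangle-\langle\bar\nabla_v(X\circ\phi),\bar\Delta^{2s-1}\tau(\phi)\rangle +\langle(\nabla_{\bar\nabla_v\bar\Delta^{s-1}\tau(\phi)}X)\circ\phi,\bar\Delta^{s-1}\tau(\phi)\rangle\\ &+\sum_{\ell=1}^{s-1}\Big(\langle(\nabla_{\bar\nabla_v\bar\Delta^{s+\ell-1}\tau(\phi)}X)\circ\phi,\bar\Delta^{s-\ell-1}\tau(\phi)\rangle +\langle(\nabla_{\bar\nabla_v\bar\Delta^{s-\ell-1}\tau(\phi)}X)\circ\phi,\bar\Delta^{s+\ell-1}\tau(\phi)\rangle\Big).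 \end{align*} Then $J^{2s+1}(\phi)$ is a smooth vector field on $M$, and on all of $M$ $$\operatorname{div}J^{2s+1}(\phi)=-\langle\tau_{2s+1}(\phi),X\circ\phi\rangle.$$ In particular, $J^{2s+1}(\phi)$ is divergence-free whenever $\phi$ is polyharmonic of order $2s+1$. -/

import Mathlib

open Bundle Manifold
open scoped ContDiff

noncomputable section

namespace Polyharmonic

section Connection

variable {E : Type*} [NormedAddCommGroup E] [NormedSpace ℝ E]
  {M : Type*} [TopologicalSpace M] [ChartedSpace E M]
  {F : Type*} [NormedAddCommGroup F] [NormedSpace ℝ F]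
  {N : Type*} [TopologicalSpace N] [ChartedSpace F N] [IsManifold 𝓘(ℝ, F) ∞ N]
  [RiemannianBundle (fun p : N ↦ TangentSpace 𝓘(ℝ, F) p)]

/-- The components `h_{αβ}(z)` of the Riemannian metric of `N` in the preferred chart at `p`,
as a bilinear form on the model space depending on the point `z` of the image of that chart. -/
def metricInChart (p : N) (z : F) : F →L[ℝ] F →L[ℝ] ℝ :=
  let q : N := (extChartAt 𝓘(ℝ, F) p).symm z
  let T : F →L[ℝ] TangentSpace 𝓘(ℝ, F) q :=
    (trivializationAt F (TangentSpace 𝓘(ℝ, F)) p).symmL ℝ q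
  (innerSL ℝ : TangentSpace 𝓘(ℝ, F) q →L[ℝ] TangentSpace 𝓘(ℝ, F) q →L[ℝ] ℝ).bilinearComp T T

/-- The Christoffel symbols of the first kind in the preferred chart at `p`, as the covector
`u ↦ ½ (∂_v h (w, u) + ∂_w h (v, u) - ∂_u h (v, w))`. -/
def christoffelFirst (p : N) (z v w : F) : F →L[ℝ] ℝ :=
  (2⁻¹ : ℝ) • (fderiv ℝ (fun y ↦ metricInChart p y w) z v
    + fderiv ℝ (fun y ↦ metricInChart p y v) z w
    - fderiv ℝ (fun y ↦ metricInChart p y v w) z)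

/-- The Christoffel symbols `Γ(v, w)^α = Γ^α_{βγ} v^β w^γ` of the Levi-Civita connection of `N` in
the preferred chart at `p`: the index of `christoffelFirst` is raised with the inverse metric. -/
def christoffel (p : N) (z v w : F) : F :=
  (metricInChart p z).inverse (christoffelFirst p z v w)

/-- The connection on `φ^* TN` induced by the Levi-Civita connection of `N`. For a section `σ`
along `φ`, `covAlong φ σ x v` is `∇̄_v σ`. In coordinates of `N` around `φ x` it is
`(∇̄_v σ)^α = d σ^α (v) + Γ^α_{βγ} d φ^β (v) σ^γ`. -/
def covAlong (φ : M → N) (σ : ∀ x, TangentSpace 𝓘(ℝ, F) (φ x)) (x : M)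
    (v : TangentSpace 𝓘(ℝ, E) x) : TangentSpace 𝓘(ℝ, F) (φ x) :=
  let p : N := φ x
  let T := trivializationAt F (TangentSpace 𝓘(ℝ, F)) p
  let dσ : F :=
    (mfderiv 𝓘(ℝ, E) 𝓘(ℝ, F) (fun y ↦ T.continuousLinearMapAt ℝ (φ y) (σ y)) x v :)
  let dφ : F := T.continuousLinearMapAt ℝ p (mfderiv 𝓘(ℝ, E) 𝓘(ℝ, F) φ x v)
  T.symmL ℝ p
    (dσ + christoffel p (extChartAt 𝓘(ℝ, F) p p) dφ (T.continuousLinearMapAt ℝ p (σ x)))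

/-- The Levi-Civita connection of `N`: `leviCivita Y p v = ∇_v Y`. -/
def leviCivita (Y : ∀ p : N, TangentSpace 𝓘(ℝ, F) p) (p : N) (v : TangentSpace 𝓘(ℝ, F) p) :
    TangentSpace 𝓘(ℝ, F) p :=
  covAlong (fun q : N ↦ q) Y p v

/-- The curvature `R(X, Y)Z = ∇_X ∇_Y Z - ∇_Y ∇_X Z - ∇_{[X, Y]} Z` of `N` on vector fields. -/
def curvatureField (X Y Z : ∀ p : N, TangentSpace 𝓘(ℝ, F) p) (p : N) :
    TangentSpace 𝓘(ℝ, F) p :=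
  leviCivita (fun q ↦ leviCivita Z q (Y q)) p (X p)
    - leviCivita (fun q ↦ leviCivita Z q (X q)) p (Y p)
    - leviCivita Z p (VectorField.mlieBracket 𝓘(ℝ, F) X Y p)

/-- The curvature tensor `R^N(u, v)w` at a point; the tangent vectors are extended to vector fields
with constant coefficients near `p`. -/
def curvature (p : N) (u v w : TangentSpace 𝓘(ℝ, F) p) : TangentSpace 𝓘(ℝ, F) p :=
  curvatureField (FiberBundle.extend F u) (FiberBundle.extend F v) (FiberBundle.extend F w) p

/-- The Lie derivative of the metric, `(L_X h)(u, v) = ⟨∇_u X, v⟩ + ⟨∇_v X, u⟩`. -/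
def lieDerivMetric (X : ∀ p : N, TangentSpace 𝓘(ℝ, F) p) (p : N)
    (u v : TangentSpace 𝓘(ℝ, F) p) : ℝ :=
  inner ℝ (leviCivita X p u) v + inner ℝ (leviCivita X p v) u

/-- `X` is a smooth vector field. -/
def IsSmoothVectorField (X : ∀ p : N, TangentSpace 𝓘(ℝ, F) p) : Prop :=
  ContMDiff 𝓘(ℝ, F) 𝓘(ℝ, F).tangent ∞ (fun p ↦ (⟨p, X p⟩ : TangentBundle 𝓘(ℝ, F) N))

/-- Killing vector fields: smooth vector fields `X` with `L_X h = 0`. -/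
def IsKilling (X : ∀ p : N, TangentSpace 𝓘(ℝ, F) p) : Prop :=
  IsSmoothVectorField X ∧ ∀ p u v, lieDerivMetric X p u v = 0

end Connection

section Maps

variable {E : Type*} [NormedAddCommGroup E] [NormedSpace ℝ E] [FiniteDimensional ℝ E]
  {M : Type*} [TopologicalSpace M] [ChartedSpace E M] [IsManifold 𝓘(ℝ, E) ∞ M]
  [RiemannianBundle (fun x : M ↦ TangentSpace 𝓘(ℝ, E) x)]
  {F : Type*} [NormedAddCommGroup F] [NormedSpace ℝ F]
  {N : Type*} [TopologicalSpace N] [ChartedSpace F N] [IsManifold 𝓘(ℝ, F) ∞ N]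
  [RiemannianBundle (fun p : N ↦ TangentSpace 𝓘(ℝ, F) p)]

instance finiteDimensional_tangentSpace (x : M) :
    FiniteDimensional ℝ (TangentSpace 𝓘(ℝ, E) x) :=
  inferInstanceAs (FiniteDimensional ℝ E)

variable (E) in
/-- An orthonormal basis `e_j` of `T_x M`. -/
def frame (x : M) :
    OrthonormalBasis (Fin (Module.finrank ℝ (TangentSpace 𝓘(ℝ, E) x))) ℝ
      (TangentSpace 𝓘(ℝ, E) x) :=
  stdOrthonormalBasis ℝ (TangentSpace 𝓘(ℝ, E) x)

/-- The divergence `div V = ∑_j ⟨∇_{e_j} V, e_j⟩` of a vector field on `M`. -/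
def divergence (V : ∀ x : M, TangentSpace 𝓘(ℝ, E) x) (x : M) : ℝ :=
  ∑ j, inner ℝ (leviCivita V x (frame E x j)) (frame E x j)

/-- The vector `η^♯` of a covector `η` at `x`. -/
def sharp (x : M) (η : TangentSpace 𝓘(ℝ, E) x → ℝ) : TangentSpace 𝓘(ℝ, E) x :=
  ∑ j, η (frame E x j) • frame E x j

/-- The differential of `φ`. -/
def dmap (φ : M → N) (x : M) (v : TangentSpace 𝓘(ℝ, E) x) : TangentSpace 𝓘(ℝ, F) (φ x) :=
  mfderiv 𝓘(ℝ, E) 𝓘(ℝ, F) φ x v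

/-- The second fundamental form `(∇̄ dφ)(u, v) = ∇̄_u (dφ(V)) - dφ(∇_u V)`, where `V` is an
extension of `v` with constant coefficients near `x`. -/
def covDmap (φ : M → N) (x : M) (u v : TangentSpace 𝓘(ℝ, E) x) :
    TangentSpace 𝓘(ℝ, F) (φ x) :=
  covAlong φ (fun y ↦ dmap φ y (FiberBundle.extend E v y)) x u
    - dmap φ x (leviCivita (FiberBundle.extend E v) x u)

variable (E F) in
/-- The tension field `τ(φ) = Tr_g ∇̄ dφ`. -/
def tension (φ : M → N) (x : M) : TangentSpace 𝓘(ℝ, F) (φ x) :=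
  ∑ j, covDmap φ x (frame E x j) (frame E x j)

/-- The second covariant derivative `∇̄_u ∇̄_V σ - ∇̄_{∇_u V} σ` of a section along `φ`, where `V`
is an extension of `v` with constant coefficients near `x`. -/
def covAlong₂ (φ : M → N) (σ : ∀ x, TangentSpace 𝓘(ℝ, F) (φ x)) (x : M)
    (u v : TangentSpace 𝓘(ℝ, E) x) : TangentSpace 𝓘(ℝ, F) (φ x) :=
  covAlong φ (fun y ↦ covAlong φ σ y (FiberBundle.extend E v y)) x u
    - covAlong φ σ x (leviCivita (FiberBundle.extend E v) x u)

variable (E) in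
/-- The rough Laplacian on `φ^* TN`, `Δ̄ = - Tr_g (∇̄ ∇̄ - ∇̄_∇)`. -/
def roughLaplacian (φ : M → N) (σ : ∀ x, TangentSpace 𝓘(ℝ, F) (φ x)) (x : M) :
    TangentSpace 𝓘(ℝ, F) (φ x) :=
  - ∑ j, covAlong₂ φ σ x (frame E x j) (frame E x j)

variable (E F) in
/-- `lapTension E F φ k = Δ̄^k τ(φ)`. -/
def lapTension (φ : M → N) (k : ℕ) : ∀ x, TangentSpace 𝓘(ℝ, F) (φ x) :=
  (roughLaplacian E φ)^[k] (tension E F φ)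

variable (E) in
/-- The trace `∑_j R^N(∇̄_{e_j} A, B) dφ(e_j)` for sections `A`, `B` along `φ`. -/
def curvTrace (φ : M → N) (A B : ∀ x, TangentSpace 𝓘(ℝ, F) (φ x)) (x : M) :
    TangentSpace 𝓘(ℝ, F) (φ x) :=
  ∑ j, curvature (φ x) (covAlong φ A x (frame E x j)) (B x) (dmap φ x (frame E x j))

variable (E) in
/-- The trace `∑_j R^N(A, ∇̄_{e_j} B) dφ(e_j)` for sections `A`, `B` along `φ`. -/
def curvTrace' (φ : M → N) (A B : ∀ x, TangentSpace 𝓘(ℝ, F) (φ x)) (x : M) :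
    TangentSpace 𝓘(ℝ, F) (φ x) :=
  ∑ j, curvature (φ x) (A x) (covAlong φ B x (frame E x j)) (dmap φ x (frame E x j))

variable (E F) in
/-- The field `τ_{2s+1}(φ)`, for `s ≥ 1`. -/
def tensionOdd (φ : M → N) (s : ℕ) (x : M) : TangentSpace 𝓘(ℝ, F) (φ x) :=
  lapTension E F φ (2 * s) x
    - ∑ j, curvature (φ x) (lapTension E F φ (2 * s - 1) x) (dmap φ x (frame E x j))
        (dmap φ x (frame E x j))
    - ∑ l ∈ Finset.Icc 1 (s - 1),
        (curvTrace E φ (lapTension E F φ (s + l - 1)) (lapTension E F φ (s - l - 1)) x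
          - curvTrace' E φ (lapTension E F φ (s + l - 1)) (lapTension E F φ (s - l - 1)) x)
    - curvTrace E φ (lapTension E F φ (s - 1)) (lapTension E F φ (s - 1)) x

variable (E F) in
/-- `φ` is polyharmonic of order `2s+1`. -/
def IsPolyharmonicOdd (φ : M → N) (s : ℕ) : Prop :=
  ∀ x, tensionOdd E F φ s x = 0

/-- The covector `v ↦ ⟨∇̄_{∇̄_v A} (X ∘ φ), B⟩ = ⟨(∇_{∇̄_v A} X) ∘ φ, B⟩`. -/
def killingTerm (φ : M → N) (X : ∀ p : N, TangentSpace 𝓘(ℝ, F) p)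
    (A B : ∀ x, TangentSpace 𝓘(ℝ, F) (φ x)) (x : M) (v : TangentSpace 𝓘(ℝ, E) x) : ℝ :=
  inner ℝ (leviCivita X (φ x) (covAlong φ A x v)) (B x)

variable (E) in
/-- The current `J^{2s+1}(φ)` associated with the vector field `X` on `N`, for `s ≥ 1`. -/
def currentOdd (φ : M → N) (X : ∀ p : N, TangentSpace 𝓘(ℝ, F) p) (s : ℕ) (x : M) :
    TangentSpace 𝓘(ℝ, E) x :=
  sharp x fun v ↦
    inner ℝ (covAlong φ (lapTension E F φ (2 * s - 1)) x v) (X (φ x))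
      - inner ℝ (covAlong φ (fun y ↦ X (φ y)) x v) (lapTension E F φ (2 * s - 1) x)
      + killingTerm φ X (lapTension E F φ (s - 1)) (lapTension E F φ (s - 1)) x v
      + ∑ l ∈ Finset.Icc 1 (s - 1),
          (killingTerm φ X (lapTension E F φ (s + l - 1)) (lapTension E F φ (s - l - 1)) x v
            + killingTerm φ X (lapTension E F φ (s - l - 1)) (lapTension E F φ (s + l - 1)) x v)

end Maps

end Polyharmonic

end

open Filter Topology

noncomputable section

set_option synthInstance.maxHeartbeats 400000
set_option linter.unusedSectionVars false
set_option maxSynthPendingDepth 3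

namespace Polyharmonic

/-! ### Derivatives of bilinear forms on the model space -/

section Calculus

variable {F : Type*} [NormedAddCommGroup F] [NormedSpace ℝ F]
  {G : Type*} [NormedAddCommGroup G] [NormedSpace ℝ G]

/-! Everything rests on two facts about a Killing field `X`: `⟨∇_u X, v⟩` is skew in `u, v`, and
therefore its second derivative is a curvature, `⟨∇²_{u,w} X, z⟩ = ⟨R(w, z)u, X⟩`
(`IsKilling.inner_covAlong₂_eq_inner`).

Write `D_k = Δ̄^k τ(φ)`. In the divergence of `⟨∇̄A, X⟩ - ⟨∇̄X, A⟩` the products of gradients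
cancel, leaving `⟨A, Δ̄(X ∘ φ)⟩ - ⟨Δ̄A, X⟩`; the chain rule turns `Δ̄(X ∘ φ)` into a curvature trace
minus `∇_τ X` (`hasDivergenceAt_jacobiTerm`). For `A = D_{2s-1}` these are the first two terms of
`-⟨τ_{2s+1}, X⟩`, with remainder `-⟨∇_τ X, D_{2s-1}⟩`.

In the divergence of `⟨∇_{∇̄A} X, B⟩ + ⟨∇_{∇̄B} X, A⟩` skewness removes the products of gradients,
`∇²X` produces the curvature traces, and `⟨∇_A X, Δ̄B⟩ - ⟨∇_{Δ̄A} X, B⟩` remains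
(`hasDivergenceAt_killingTerm_add_swap`). For `A = D_{s+l-1}`, `B = D_{s-l-1}` this is `a_{l-1} -
a_l` with `a_l = ⟨∇_{D_{s+l}} X, D_{s-l-1}⟩`, so the sum over `l` telescopes to `a_0 - a_{s-1}`. The
middle form, with `A = B = D_{s-1}`, contributes `-a_0`, and by skewness `-a_{s-1}` cancels the
first remainder.

The rest makes this calculus available from pointwise definitions: the connection at `x` uses the
preferred chart at `φ x`, second derivatives use extensions with constant coefficients, and
orthonormal bases are chosen independently at each point. The transformation law
`christoffel_transition` lets the connection be computed in one fixed chart near a point,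
`covAlong_hom_sub` removes the dependence on extensions, and `SmoothAlong.trace` gives smooth
traces. Smoothness is always asked on a neighbourhood, because being `C^∞` at one point in the sense
of `ContMDiffAt` does not give it at nearby points. -/

/-- The derivative of a bilinear form `H` pulled back under a change of variables. -/
theorem fderiv_pullback_bilinear {H : F → F →L[ℝ] F →L[ℝ] ℝ} {ψ : F → F} {w : F}
    (hH : DifferentiableAt ℝ H (ψ w)) (hψ : ContDiffAt ℝ 2 ψ w) (a b c : F) :
    fderiv ℝ (fun z ↦ H (ψ z) (fderiv ℝ ψ z a) (fderiv ℝ ψ z b)) w c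
      = fderiv ℝ H (ψ w) (fderiv ℝ ψ w c) (fderiv ℝ ψ w a) (fderiv ℝ ψ w b)
        + H (ψ w) (fderiv ℝ (fderiv ℝ ψ) w c a) (fderiv ℝ ψ w b)
        + H (ψ w) (fderiv ℝ ψ w a) (fderiv ℝ (fderiv ℝ ψ) w c b) := by
  have h1 : HasFDerivAt ψ (fderiv ℝ ψ w) w :=
    (hψ.differentiableAt (by norm_num)).hasFDerivAt
  have h2 : HasFDerivAt (fderiv ℝ ψ) (fderiv ℝ (fderiv ℝ ψ) w) w :=
    ((hψ.fderiv_right (m := 1) (by norm_num)).differentiableAt (by norm_num)).hasFDerivAt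
  have h3 : HasFDerivAt (fun z ↦ H (ψ z)) (fderiv ℝ H (ψ w) ∘L fderiv ℝ ψ w) w :=
    HasFDerivAt.comp w hH.hasFDerivAt h1
  have h4 := (h3.clm_apply (h2.clm_apply (hasFDerivAt_const a w))).clm_apply
    (h2.clm_apply (hasFDerivAt_const b w))
  rw [h4.fderiv]
  simp
  ring

theorem fderiv_apply_const_apply {H : F → F →L[ℝ] G} {z : F}
    (hH : DifferentiableAt ℝ H z) (a c : F) :
    fderiv ℝ (fun y ↦ H y a) z c = fderiv ℝ H z c a := by
  rw [(hH.hasFDerivAt.clm_apply (hasFDerivAt_const a z)).fderiv]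
  simp

end Calculus

/-! ### The metric and the Christoffel symbols in a chart -/

section Coordinates

variable {F : Type*} [NormedAddCommGroup F] [NormedSpace ℝ F]
  {N : Type*} [TopologicalSpace N] [ChartedSpace F N] [IsManifold 𝓘(ℝ, F) ∞ N]

/-- The components at `q` of tangent vectors in the preferred chart at `p`. -/
def coord (p q : N) : TangentSpace 𝓘(ℝ, F) q →L[ℝ] F :=
  (trivializationAt F (TangentSpace 𝓘(ℝ, F)) p).continuousLinearMapAt ℝ q

/-- The tangent vector at `q` with given components in the preferred chart at `p`. -/
def coordSymm (p q : N) : F →L[ℝ] TangentSpace 𝓘(ℝ, F) q :=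
  (trivializationAt F (TangentSpace 𝓘(ℝ, F)) p).symmL ℝ q

theorem coordSymm_coord {p q : N} (hq : q ∈ (chartAt F p).source) (v : TangentSpace 𝓘(ℝ, F) q) :
    coordSymm p q (coord p q v) = v :=
  (trivializationAt F (TangentSpace 𝓘(ℝ, F)) p).symmL_continuousLinearMapAt hq v

theorem coord_coordSymm {p q : N} (hq : q ∈ (chartAt F p).source) (v : F) :
    coord p q (coordSymm p q v) = v :=
  (trivializationAt F (TangentSpace 𝓘(ℝ, F)) p).continuousLinearMapAt_symmL hq v

theorem coord_eq_trivialization {p q : N} (hq : q ∈ (chartAt F p).source)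
    (v : TangentSpace 𝓘(ℝ, F) q) :
    (trivializationAt F (TangentSpace 𝓘(ℝ, F)) p ⟨q, v⟩).2 = coord p q v := by
  rw [coord, Trivialization.continuousLinearMapAt_apply, Trivialization.linearMapAt_apply, if_pos]
  exact hq

theorem coord_eq_mfderiv {p q : N} (hq : q ∈ (chartAt F p).source)
    (v : TangentSpace 𝓘(ℝ, F) q) :
    coord p q v = mfderiv 𝓘(ℝ, F) 𝓘(ℝ, F) (extChartAt 𝓘(ℝ, F) p) q v := by
  have := TangentBundle.continuousLinearMapAt_trivializationAt (I := 𝓘(ℝ, F)) hq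
  exact DFunLike.congr_fun this v

/-- `FiberBundle.extend` keeps the components in the trivialization at `p` fixed, so on the whole
chart domain it is a constant-coefficient combination of coordinate fields. -/
theorem coord_extend {p q : N} (hq : q ∈ (chartAt F p).source) (v : TangentSpace 𝓘(ℝ, F) p) :
    coord p q (FiberBundle.extend F v q) = coord p p v := by
  rw [← coord_coordSymm hq (coord p p v), FiberBundle.extend,
    coord_eq_trivialization (mem_chart_source F p), coordSymm, Trivialization.symmL_apply _ hq]

theorem extChartAt_target_mem {p q : N} (hq : q ∈ (chartAt F p).source) :
    (extChartAt 𝓘(ℝ, F) p).target ∈ 𝓝 (extChartAt 𝓘(ℝ, F) p q) := by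
  refine (isOpen_extChartAt_target p).mem_nhds ((extChartAt 𝓘(ℝ, F) p).map_source ?_)
  simpa using hq

theorem extChartAt_symm_mem_source {p : N} {z : F} (hz : z ∈ (extChartAt 𝓘(ℝ, F) p).target) :
    (extChartAt 𝓘(ℝ, F) p).symm z ∈ (chartAt F p).source := by
  have := (extChartAt 𝓘(ℝ, F) p).map_target hz
  simpa using this

theorem contMDiffOn_coordSymm (p : N) (a : F) :
    ContMDiffOn 𝓘(ℝ, F) 𝓘(ℝ, F).tangent ∞
      (fun q ↦ (⟨q, coordSymm p q a⟩ : TangentBundle 𝓘(ℝ, F) N)) (chartAt F p).source := by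
  intro q hq
  refine ContMDiffAt.contMDiffWithinAt ?_
  rw [(trivializationAt F (TangentSpace 𝓘(ℝ, F)) p).contMDiffAt_iff (f := fun q ↦
    (⟨q, coordSymm p q a⟩ : TangentBundle 𝓘(ℝ, F) N)) (by simpa using hq)]
  refine ⟨contMDiffAt_id, (contMDiffAt_const (c := a)).congr_of_eventuallyEq ?_⟩
  filter_upwards [(chartAt F p).open_source.mem_nhds hq] with y hy
  rw [coord_eq_trivialization hy, coord_coordSymm hy]

variable [RiemannianBundle (fun p : N ↦ TangentSpace 𝓘(ℝ, F) p)]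

theorem metricInChart_extChartAt {p q : N} (hq : q ∈ (chartAt F p).source) (a b : F) :
    metricInChart p (extChartAt 𝓘(ℝ, F) p q) a b
      = inner ℝ (coordSymm p q a) (coordSymm p q b) := by
  have h : (extChartAt 𝓘(ℝ, F) p).symm (extChartAt 𝓘(ℝ, F) p q) = q :=
    (extChartAt 𝓘(ℝ, F) p).left_inv (by simpa using hq)
  -- The fibre carrying the inner product depends on the base point, so `h` is applied by
  -- substituting a variable point instead of rewriting.
  have : ∀ q', q' = q → inner ℝ (coordSymm p q' a) (coordSymm p q' b)
      = (inner ℝ (coordSymm p q a) (coordSymm p q b) : ℝ) := by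
    rintro _ rfl; rfl
  exact this _ h

theorem inner_eq_metricInChart {p q : N} (hq : q ∈ (chartAt F p).source)
    (a b : TangentSpace 𝓘(ℝ, F) q) :
    inner ℝ a b = metricInChart p (extChartAt 𝓘(ℝ, F) p q) (coord p q a) (coord p q b) := by
  rw [metricInChart_extChartAt hq, coordSymm_coord hq, coordSymm_coord hq]

theorem metricInChart_symm (p : N) (z a b : F) : metricInChart p z a b = metricInChart p z b a :=
  real_inner_comm (coordSymm p ((extChartAt 𝓘(ℝ, F) p).symm z) b)
    (coordSymm p ((extChartAt 𝓘(ℝ, F) p).symm z) a)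

theorem coordSymm_injective {p q : N} (hq : q ∈ (chartAt F p).source) :
    Function.Injective (coordSymm (F := F) p q) :=
  Function.LeftInverse.injective (coord_coordSymm hq)

theorem metricInChart_nondegenerate {p : N} {z : F} (hz : z ∈ (extChartAt 𝓘(ℝ, F) p).target)
    {a : F} (ha : ∀ b, metricInChart p z a b = 0) : a = 0 := by
  have h : inner ℝ (coordSymm p ((extChartAt 𝓘(ℝ, F) p).symm z) a)
    (coordSymm p ((extChartAt 𝓘(ℝ, F) p).symm z) a) = (0 : ℝ) := ha a
  rw [inner_self_eq_zero] at h
  exact coordSymm_injective (extChartAt_symm_mem_source hz) (h.trans (map_zero _).symm)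

variable [FiniteDimensional ℝ F]

/-- Positive definiteness makes lowering an index injective, and equality of dimensions makes it
bijective. Without this, `inverse` in `christoffel` would be its default value `0`. -/
theorem isInvertible_metricInChart {p : N} {z : F} (hz : z ∈ (extChartAt 𝓘(ℝ, F) p).target) :
    (metricInChart p z).IsInvertible := by
  have hinj : Function.Injective (metricInChart p z) := by
    rw [injective_iff_map_eq_zero]
    intro a ha
    exact metricInChart_nondegenerate hz fun b ↦ by rw [ha]; rfl
  have hdim : Module.finrank ℝ F = Module.finrank ℝ (F →L[ℝ] ℝ) := by
    rw [← (LinearMap.toContinuousLinearMap : (F →ₗ[ℝ] ℝ) ≃ₗ[ℝ] (F →L[ℝ] ℝ)).finrank_eq]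
    exact (Subspace.dual_finrank_eq (K := ℝ) (V := F)).symm
  let e := LinearEquiv.ofInjectiveOfFinrankEq (metricInChart p z : F →ₗ[ℝ] F →L[ℝ] ℝ) hinj hdim
  exact ⟨e.toContinuousLinearEquiv, by ext; rfl⟩

theorem metricInChart_christoffel {p : N} {z : F} (hz : z ∈ (extChartAt 𝓘(ℝ, F) p).target)
    (v w : F) : metricInChart p z (christoffel p z v w) = christoffelFirst p z v w := by
  obtain ⟨e, he⟩ := isInvertible_metricInChart hz
  rw [christoffel, ← he, ContinuousLinearMap.inverse_equiv]
  simp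

omit [FiniteDimensional ℝ F] in
theorem christoffel_symm (p : N) (z v w : F) : christoffel p z v w = christoffel p z w v := by
  simp only [christoffel, christoffelFirst, metricInChart_symm p _ v w]
  rw [add_comm (fderiv ℝ (fun y ↦ metricInChart p y w) z v)]

variable [IsContMDiffRiemannianBundle 𝓘(ℝ, F) ∞ F (fun p : N ↦ TangentSpace 𝓘(ℝ, F) p)]

theorem contDiffOn_metricInChart (p : N) :
    ContDiffOn ℝ ∞ (metricInChart p) (extChartAt 𝓘(ℝ, F) p).target := by
  rw [contDiffOn_clm_apply]
  intro a
  rw [contDiffOn_clm_apply]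
  intro b
  have h : ContMDiffOn 𝓘(ℝ, F) 𝓘(ℝ) ∞
      (fun q ↦ (inner ℝ (coordSymm p q a) (coordSymm p q b) : ℝ)) (chartAt F p).source :=
    ContMDiffOn.inner_bundle (contMDiffOn_coordSymm p a) (contMDiffOn_coordSymm p b)
  replace h := h.comp
    (contMDiffOn_extChartAt_symm p) (fun z hz ↦ extChartAt_symm_mem_source hz)
  exact h.contDiffOn

theorem contDiffAt_metricInChart {p : N} {z : F} (hz : z ∈ (extChartAt 𝓘(ℝ, F) p).target) :
    ContDiffAt ℝ ∞ (metricInChart p) z :=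
  (contDiffOn_metricInChart p).contDiffAt ((isOpen_extChartAt_target p).mem_nhds hz)

theorem differentiableAt_metricInChart {p : N} {z : F}
    (hz : z ∈ (extChartAt 𝓘(ℝ, F) p).target) : DifferentiableAt ℝ (metricInChart p) z :=
  (contDiffAt_metricInChart hz).differentiableAt (by simp)

theorem christoffelFirst_apply {p : N} {z : F} (hz : z ∈ (extChartAt 𝓘(ℝ, F) p).target)
    (v w u : F) :
    christoffelFirst p z v w u = 2⁻¹ * (fderiv ℝ (metricInChart p) z v w u
      + fderiv ℝ (metricInChart p) z w v u - fderiv ℝ (metricInChart p) z u v w) := by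
  have h := differentiableAt_metricInChart hz
  simp only [christoffelFirst, _root_.smul_apply, _root_.sub_apply,
    _root_.add_apply, smul_eq_mul]
  rw [fderiv_apply_const_apply h, fderiv_apply_const_apply h,
    fderiv_apply_const_apply (H := fun y ↦ metricInChart p y v)
      (h.clm_apply (differentiableAt_const v)), fderiv_apply_const_apply h]

/-- The Christoffel symbols define a bilinear map. -/
theorem christoffel_add_left {p : N} {z : F} (hz : z ∈ (extChartAt 𝓘(ℝ, F) p).target)
    (v v' w : F) : christoffel p z (v + v') w = christoffel p z v w + christoffel p z v' w := by
  rw [christoffel, christoffel, christoffel, ← map_add]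
  congr 1
  ext u
  simp only [_root_.add_apply, christoffelFirst_apply hz, map_add]
  ring

theorem christoffel_smul_left {p : N} {z : F} (hz : z ∈ (extChartAt 𝓘(ℝ, F) p).target)
    (c : ℝ) (v w : F) : christoffel p z (c • v) w = c • christoffel p z v w := by
  rw [christoffel, christoffel, ← map_smul]
  congr 1
  ext u
  simp only [_root_.smul_apply, christoffelFirst_apply hz, map_smul, smul_eq_mul]
  ring

theorem christoffel_add_right {p : N} {z : F} (hz : z ∈ (extChartAt 𝓘(ℝ, F) p).target)
    (v w w' : F) : christoffel p z v (w + w') = christoffel p z v w + christoffel p z v w' := by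
  simp only [christoffel_symm p z v, christoffel_add_left hz]

theorem christoffel_smul_right {p : N} {z : F} (hz : z ∈ (extChartAt 𝓘(ℝ, F) p).target)
    (c : ℝ) (v w : F) : christoffel p z v (c • w) = c • christoffel p z v w := by
  simp only [christoffel_symm p z v, christoffel_smul_left hz]

/-- The Christoffel symbols express that the metric is parallel. -/
theorem fderiv_metricInChart {p : N} {z : F} (hz : z ∈ (extChartAt 𝓘(ℝ, F) p).target)
    (v a b : F) : fderiv ℝ (metricInChart p) z v a b
      = metricInChart p z (christoffel p z v a) b + metricInChart p z a (christoffel p z v b) := by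
  have hs : ∀ u a b : F, fderiv ℝ (metricInChart p) z u a b
      = fderiv ℝ (metricInChart p) z u b a := by
    intro u a b
    have h := differentiableAt_metricInChart hz
    rw [← fderiv_apply_const_apply h, ← fderiv_apply_const_apply h,
      ← fderiv_apply_const_apply (H := fun y ↦ metricInChart p y a)
        (h.clm_apply (differentiableAt_const a)),
      ← fderiv_apply_const_apply (H := fun y ↦ metricInChart p y b)
        (h.clm_apply (differentiableAt_const b))]
    simp only [metricInChart_symm p _ a b]
  -- In the sum of the two Christoffel symbols of the first kind the derivatives in the directions
  -- `a` and `b` cancel by symmetry of the metric; the two halves in the direction `v` add up.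
  rw [metricInChart_symm p z a, metricInChart_christoffel hz, metricInChart_christoffel hz,
    christoffelFirst_apply hz, christoffelFirst_apply hz, hs a v b, hs b v a, hs v b a]
  ring

theorem contDiffAt_christoffel {X : Type*} [NormedAddCommGroup X] [NormedSpace ℝ X]
    {p : N} {x : X} {f a b : X → F}
    (hz : f x ∈ (extChartAt 𝓘(ℝ, F) p).target)
    (hf : ContDiffAt ℝ ∞ f x) (ha : ContDiffAt ℝ ∞ a x) (hb : ContDiffAt ℝ ∞ b x) :
    ContDiffAt ℝ ∞ (fun y ↦ christoffel p (f y) (a y) (b y)) x := by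
  have hD : ContDiffAt ℝ ∞ (fun y ↦ fderiv ℝ (metricInChart p) (f y)) x :=
    ContDiffAt.comp x ((contDiffAt_metricInChart hz).fderiv_right (m := ∞) (by simp)) hf
  have hI : ContDiffAt ℝ ∞ (fun y ↦ (metricInChart p (f y)).inverse) x :=
    ContDiffAt.comp (g := ContinuousLinearMap.inverse) (f := fun y ↦ metricInChart p (f y)) x
      (isInvertible_metricInChart hz).contDiffAt_map_inverse
      (ContDiffAt.comp x (contDiffAt_metricInChart hz) hf)
  -- The third summand, the covector `u ↦ ∂_u h(a, b)`, is written as the derivative of the metric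
  -- followed by two evaluation maps, which exhibits its smoothness.
  have hfirst : ContDiffAt ℝ ∞ (fun y ↦ (2⁻¹ : ℝ) •
      (fderiv ℝ (metricInChart p) (f y) (a y) (b y) + fderiv ℝ (metricInChart p) (f y) (b y) (a y)
        - ((ContinuousLinearMap.apply ℝ ℝ (b y)).comp
            ((ContinuousLinearMap.apply ℝ (F →L[ℝ] ℝ) (a y)).comp
            (fderiv ℝ (metricInChart p) (f y)))))) x := by
    refine ContDiffAt.const_smul _ (ContDiffAt.sub (ContDiffAt.add ?_ ?_) ?_)
    · exact (hD.clm_apply ha).clm_apply hb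
    · exact (hD.clm_apply hb).clm_apply ha
    · exact ((ContinuousLinearMap.contDiff _).comp_contDiffAt x hb).clm_comp
        (((ContinuousLinearMap.contDiff _).comp_contDiffAt x ha).clm_comp hD)
  refine (hI.clm_apply hfirst).congr_of_eventuallyEq ?_
  filter_upwards [hf.continuousAt.preimage_mem_nhds
    ((isOpen_extChartAt_target p).mem_nhds hz)] with y hy
  rw [christoffel]
  congr 1
  ext u
  rw [christoffelFirst_apply hy]
  simp

end Coordinates


/-! ### Derivatives of vector-valued functions on a manifold -/

section VectorValued

variable {E : Type*} [NormedAddCommGroup E] [NormedSpace ℝ E]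
  {M : Type*} [TopologicalSpace M] [ChartedSpace E M]
  {F : Type*} [NormedAddCommGroup F] [NormedSpace ℝ F]
  {G : Type*} [NormedAddCommGroup G] [NormedSpace ℝ G]

theorem _root_.Filter.EventuallyEq.mvfderiv_eq {f g : M → F} {x : M} (h : f =ᶠ[𝓝 x] g) :
    mvfderiv 𝓘(ℝ, E) f x = mvfderiv 𝓘(ℝ, E) g x := by
  ext v
  exact DFunLike.congr_fun (h.mfderiv_eq (I := 𝓘(ℝ, E)) (I' := 𝓘(ℝ, F))) v

theorem mvfderiv_clm_apply {g : M → F →L[ℝ] G} {f : M → F} {x : M}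
    (hg : MDifferentiableAt 𝓘(ℝ, E) 𝓘(ℝ, F →L[ℝ] G) g x)
    (hf : MDifferentiableAt 𝓘(ℝ, E) 𝓘(ℝ, F) f x) (v : TangentSpace 𝓘(ℝ, E) x) :
    mvfderiv 𝓘(ℝ, E) (fun y ↦ g y (f y)) x v
      = mvfderiv 𝓘(ℝ, E) g x v (f x) + g x (mvfderiv 𝓘(ℝ, E) f x v) := by
  have h := HasFDerivWithinAt.clm_apply hg.hasMFDerivAt.2 hf.hasMFDerivAt.2
  have h' : HasMFDerivAt 𝓘(ℝ, E) 𝓘(ℝ, G) (fun y ↦ g y (f y)) x _ :=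
    ⟨hg.continuousAt.clm_apply hf.continuousAt, h⟩
  have := DFunLike.congr_fun h'.mfderiv v
  refine this.trans ?_
  simp [add_comm]
  rfl

theorem mvfderiv_comp_fderiv {g : F → G} {g' : F →L[ℝ] G} {f : M → F} {x : M}
    (hg : HasFDerivAt g g' (f x)) (hf : MDifferentiableAt 𝓘(ℝ, E) 𝓘(ℝ, F) f x)
    (v : TangentSpace 𝓘(ℝ, E) x) :
    mvfderiv 𝓘(ℝ, E) (fun y ↦ g (f y)) x v = g' (mvfderiv 𝓘(ℝ, E) f x v) :=
  DFunLike.congr_fun ((HasFDerivAt.hasMFDerivAt hg).comp x hf.hasMFDerivAt).mfderiv v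

end VectorValued

/-! ### Changes of chart and the transformation law of the Christoffel symbols -/

section Transition

variable {F : Type*} [NormedAddCommGroup F] [NormedSpace ℝ F]
  {N : Type*} [TopologicalSpace N] [ChartedSpace F N] [IsManifold 𝓘(ℝ, F) ∞ N]

/-- The change of coordinates from the preferred chart at `q` to the preferred chart at `p`. -/
def transition (p q : N) : F → F := extChartAt 𝓘(ℝ, F) p ∘ (extChartAt 𝓘(ℝ, F) q).symm

theorem transition_extChartAt {p q r : N} (hq : r ∈ (chartAt F q).source) :
    transition p q (extChartAt 𝓘(ℝ, F) q r) = extChartAt 𝓘(ℝ, F) p r := by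
  rw [transition, Function.comp_apply, (extChartAt 𝓘(ℝ, F) q).left_inv (by simpa using hq)]

/-- Components of tangent vectors change by the Jacobian of the chart change; this connects the
trivializations of the tangent bundle with calculus on the model space. -/
theorem fderiv_transition {p q r : N} (hp : r ∈ (chartAt F p).source)
    (hq : r ∈ (chartAt F q).source) (a : F) :
    fderiv ℝ (transition p q) (extChartAt 𝓘(ℝ, F) q r) a = coord p r (coordSymm q r a) := by
  have h := hasFDerivWithinAt_tangentCoordChange (I := 𝓘(ℝ, F)) (x := q) (y := p) (z := r)
    ⟨by simpa using hq, by simpa using hp⟩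
  rw [modelWithCornersSelf_coe, Set.range_id, hasFDerivWithinAt_univ] at h
  have h' : fderiv ℝ (transition p q) (extChartAt 𝓘(ℝ, F) q r)
    = tangentCoordChange 𝓘(ℝ, F) q p r := h.fderiv
  rw [h', coord, coordSymm, TangentBundle.continuousLinearMapAt_trivializationAt_eq_core hp,
    TangentBundle.symmL_trivializationAt_eq_core hq]
  exact (tangentCoordChange_comp (I := 𝓘(ℝ, F)) (w := q) (x := r) (y := p) (z := r)
    ⟨⟨by simpa using hq, by simp⟩, by simpa using hp⟩).symm

theorem contDiffAt_transition {p q r : N} (hp : r ∈ (chartAt F p).source)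
    (hq : r ∈ (chartAt F q).source) :
    ContDiffAt ℝ ∞ (transition p q) (extChartAt 𝓘(ℝ, F) q r) := by
  have h := contDiffWithinAt_ext_coord_change (I := 𝓘(ℝ, F)) (n := ∞) p q
    (y := extChartAt 𝓘(ℝ, F) q r) (by
      rw [PartialEquiv.trans_source'', PartialEquiv.symm_symm, PartialEquiv.symm_target]
      exact Set.mem_image_of_mem _ ⟨by simpa using hq, by simpa using hp⟩)
  rwa [modelWithCornersSelf_coe, Set.range_id, contDiffWithinAt_univ] at h

theorem eventually_extChartAt {q r : N} (hq : r ∈ (chartAt F q).source) {P : N → Prop}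
    (hP : ∀ᶠ r' in 𝓝 r, P r') :
    ∀ᶠ z in 𝓝 (extChartAt 𝓘(ℝ, F) q r), ∃ r', r' ∈ (chartAt F q).source ∧ P r' ∧
      extChartAt 𝓘(ℝ, F) q r' = z := by
  have hq' : r ∈ (extChartAt 𝓘(ℝ, F) q).source := by simpa using hq
  have hc : Tendsto (extChartAt 𝓘(ℝ, F) q).symm (𝓝 (extChartAt 𝓘(ℝ, F) q r)) (𝓝 r) := by
    have := continuousAt_extChartAt_symm' (I := 𝓘(ℝ, F)) hq'
    rwa [ContinuousAt, (extChartAt 𝓘(ℝ, F) q).left_inv hq'] at this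
  filter_upwards [hc.eventually hP, extChartAt_target_mem hq] with z h1 h2
  exact ⟨_, extChartAt_symm_mem_source h2, h1, (extChartAt 𝓘(ℝ, F) q).right_inv h2⟩

theorem extChartAt_mem_target {p r : N} (hp : r ∈ (chartAt F p).source) :
    extChartAt 𝓘(ℝ, F) p r ∈ (extChartAt 𝓘(ℝ, F) p).target :=
  mem_of_mem_nhds (extChartAt_target_mem hp)

variable [RiemannianBundle (fun p : N ↦ TangentSpace 𝓘(ℝ, F) p)]

theorem metricInChart_transition {p q r : N} (hp : r ∈ (chartAt F p).source)
    (hq : r ∈ (chartAt F q).source) (a b : F) :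
    metricInChart q (extChartAt 𝓘(ℝ, F) q r) a b
      = metricInChart p (extChartAt 𝓘(ℝ, F) p r)
        (fderiv ℝ (transition p q) (extChartAt 𝓘(ℝ, F) q r) a)
        (fderiv ℝ (transition p q) (extChartAt 𝓘(ℝ, F) q r) b) := by
  rw [fderiv_transition hp hq, fderiv_transition hp hq, ← inner_eq_metricInChart hp,
    metricInChart_extChartAt hq]

variable [FiniteDimensional ℝ F]
  [IsContMDiffRiemannianBundle 𝓘(ℝ, F) ∞ F (fun p : N ↦ TangentSpace 𝓘(ℝ, F) p)]

/-- The transformation law of the Christoffel symbols. -/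
theorem christoffel_transition {p q r : N} (hp : r ∈ (chartAt F p).source)
    (hq : r ∈ (chartAt F q).source) (v u : F) :
    fderiv ℝ (transition p q) (extChartAt 𝓘(ℝ, F) q r)
        (christoffel q (extChartAt 𝓘(ℝ, F) q r) v u)
      = fderiv ℝ (fderiv ℝ (transition p q)) (extChartAt 𝓘(ℝ, F) q r) v u
        + christoffel p (extChartAt 𝓘(ℝ, F) p r)
          (fderiv ℝ (transition p q) (extChartAt 𝓘(ℝ, F) q r) v)
          (fderiv ℝ (transition p q) (extChartAt 𝓘(ℝ, F) q r) u) := by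
  have hpz := extChartAt_mem_target hp
  have hqz := extChartAt_mem_target hq
  have hψ := contDiffAt_transition hp hq
  have hT := transition_extChartAt (p := p) hq
  have hG : ∀ a b c, fderiv ℝ (metricInChart q) (extChartAt 𝓘(ℝ, F) q r) c a b = 
      fderiv ℝ (metricInChart p) (transition p q (extChartAt 𝓘(ℝ, F) q r))
          (fderiv ℝ (transition p q) (extChartAt 𝓘(ℝ, F) q r) c)
          (fderiv ℝ (transition p q) (extChartAt 𝓘(ℝ, F) q r) a)
          (fderiv ℝ (transition p q) (extChartAt 𝓘(ℝ, F) q r) b)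
        + metricInChart p (transition p q (extChartAt 𝓘(ℝ, F) q r))
          (fderiv ℝ (fderiv ℝ (transition p q)) (extChartAt 𝓘(ℝ, F) q r) c a)
          (fderiv ℝ (transition p q) (extChartAt 𝓘(ℝ, F) q r) b)
        + metricInChart p (transition p q (extChartAt 𝓘(ℝ, F) q r))
          (fderiv ℝ (transition p q) (extChartAt 𝓘(ℝ, F) q r) a)
          (fderiv ℝ (fderiv ℝ (transition p q)) (extChartAt 𝓘(ℝ, F) q r) c b) := by
    intro a b c
    have h := differentiableAt_metricInChart hqz
    rw [← fderiv_apply_const_apply h, ← fderiv_apply_const_apply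
      (H := fun y ↦ metricInChart q y a) (h.clm_apply (differentiableAt_const a))]
    have hev : (fun z ↦ metricInChart q z a b) =ᶠ[𝓝 (extChartAt 𝓘(ℝ, F) q r)]
        fun z ↦ metricInChart p (transition p q z) (fderiv ℝ (transition p q) z a)
          (fderiv ℝ (transition p q) z b) := by
      filter_upwards [eventually_extChartAt hq ((chartAt F p).open_source.mem_nhds hp)]
      rintro _ ⟨r', h1, h2, rfl⟩
      rw [transition_extChartAt h1, metricInChart_transition h2 h1]
    rw [hev.fderiv_eq]
    exact fderiv_pullback_bilinear (by rw [hT]; exact differentiableAt_metricInChart hpz)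
      (hψ.of_le (WithTop.coe_le_coe.2 le_top)) a b c
  -- By nondegeneracy it is enough to pair with vectors, and each is `Dψ k` for some `k`, where `ψ`
  -- is the chart change. Of the six terms in `D²ψ` coming from `hG`, symmetry cancels four in pairs
  -- and makes the other two equal.
  rw [← sub_eq_zero]
  refine metricInChart_nondegenerate hpz fun b ↦ ?_
  obtain ⟨k, rfl⟩ : ∃ k, fderiv ℝ (transition p q) (extChartAt 𝓘(ℝ, F) q r) k = b :=
    ⟨coord q r (coordSymm p r b), by
      rw [fderiv_transition hp hq, coordSymm_coord hq, coord_coordSymm hp]⟩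
  have hsymm : ∀ a b, fderiv ℝ (fderiv ℝ (transition p q)) (extChartAt 𝓘(ℝ, F) q r) a b
      = fderiv ℝ (fderiv ℝ (transition p q)) (extChartAt 𝓘(ℝ, F) q r) b a := fun a b ↦
    ((hψ.of_le (n := ∞) (m := 2) (WithTop.coe_le_coe.2 le_top)).isSymmSndFDerivAt (by simp)).eq a b
  rw [map_sub, map_add, _root_.sub_apply, _root_.add_apply, ← metricInChart_transition hp hq,
    metricInChart_christoffel hqz, metricInChart_christoffel hpz, christoffelFirst_apply hqz,
    christoffelFirst_apply hpz, hG, hG, hG, hT, hsymm k v, hsymm k u, hsymm u v,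
    metricInChart_symm p _ (fderiv ℝ (fderiv ℝ (transition p q)) _ v k)]
  ring

end Transition

/-! ### The connection along a map in an arbitrary chart -/

section CovAlong

variable {E : Type*} [NormedAddCommGroup E] [NormedSpace ℝ E]
  {M : Type*} [TopologicalSpace M] [ChartedSpace E M]
  {F : Type*} [NormedAddCommGroup F] [NormedSpace ℝ F] [FiniteDimensional ℝ F]
  {N : Type*} [TopologicalSpace N] [ChartedSpace F N] [IsManifold 𝓘(ℝ, F) ∞ N]
  [RiemannianBundle (fun p : N ↦ TangentSpace 𝓘(ℝ, F) p)]
  [IsContMDiffRiemannianBundle 𝓘(ℝ, F) ∞ F (fun p : N ↦ TangentSpace 𝓘(ℝ, F) p)]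

/-- The components of a section along `φ` in the preferred chart at `p`. -/
def coordAlong (p : N) (φ : M → N) (σ : ∀ x, TangentSpace 𝓘(ℝ, F) (φ x)) (x : M) : F :=
  coord p (φ x) (σ x)

omit [FiniteDimensional ℝ F] [IsContMDiffRiemannianBundle 𝓘(ℝ, F) ∞ F
  (fun p : N ↦ TangentSpace 𝓘(ℝ, F) p)] in
theorem coord_covAlong_self (φ : M → N) (σ : ∀ x, TangentSpace 𝓘(ℝ, F) (φ x)) (x : M)
    (v : TangentSpace 𝓘(ℝ, E) x) :
    coord (φ x) (φ x) (covAlong φ σ x v)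
      = mvfderiv 𝓘(ℝ, E) (coordAlong (φ x) φ σ) x v
        + christoffel (φ x) (extChartAt 𝓘(ℝ, F) (φ x) (φ x))
          (coord (φ x) (φ x) (mfderiv 𝓘(ℝ, E) 𝓘(ℝ, F) φ x v)) (coordAlong (φ x) φ σ x) :=
  coord_coordSymm (mem_chart_source F (φ x)) _

omit [FiniteDimensional ℝ F] [RiemannianBundle (fun p : N ↦ TangentSpace 𝓘(ℝ, F) p)]
  [IsContMDiffRiemannianBundle 𝓘(ℝ, F) ∞ F (fun p : N ↦ TangentSpace 𝓘(ℝ, F) p)] in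
theorem mdifferentiableAt_coordAlong {p : N} {φ : M → N}
    {σ : ∀ x, TangentSpace 𝓘(ℝ, F) (φ x)} {x : M} (hp : φ x ∈ (chartAt F p).source)
    (hσ : MDifferentiableAt 𝓘(ℝ, E) 𝓘(ℝ, F).tangent
      (fun y ↦ (⟨φ y, σ y⟩ : TangentBundle 𝓘(ℝ, F) N)) x) :
    MDifferentiableAt 𝓘(ℝ, E) 𝓘(ℝ, F) (coordAlong p φ σ) x := by
  have hφ : MDifferentiableAt 𝓘(ℝ, E) 𝓘(ℝ, F) φ x :=
    (mdifferentiableAt_totalSpace _ _).1 hσ |>.1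
  have h := ((trivializationAt F (TangentSpace 𝓘(ℝ, F)) p).mdifferentiableAt_totalSpace_iff
    𝓘(ℝ, F) (f := fun y ↦ (⟨φ y, σ y⟩ : TangentBundle 𝓘(ℝ, F) N)) (by simpa using hp)).1 hσ |>.2
  refine h.congr_of_eventuallyEq ?_
  filter_upwards [hφ.continuousAt.preimage_mem_nhds
    ((chartAt F p).open_source.mem_nhds hp)] with y hy
  exact (coord_eq_trivialization hy _).symm

omit [FiniteDimensional ℝ F] [RiemannianBundle (fun p : N ↦ TangentSpace 𝓘(ℝ, F) p)]
  [IsContMDiffRiemannianBundle 𝓘(ℝ, F) ∞ F (fun p : N ↦ TangentSpace 𝓘(ℝ, F) p)] in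
theorem mdifferentiableAt_extChartAt_comp {p : N} {φ : M → N} {x : M}
    (hp : φ x ∈ (chartAt F p).source) (hφ : MDifferentiableAt 𝓘(ℝ, E) 𝓘(ℝ, F) φ x) :
    MDifferentiableAt 𝓘(ℝ, E) 𝓘(ℝ, F) (fun y ↦ extChartAt 𝓘(ℝ, F) p (φ y)) x :=
  (mdifferentiableAt_extChartAt hp).comp x hφ

omit [FiniteDimensional ℝ F] [RiemannianBundle (fun p : N ↦ TangentSpace 𝓘(ℝ, F) p)]
  [IsContMDiffRiemannianBundle 𝓘(ℝ, F) ∞ F (fun p : N ↦ TangentSpace 𝓘(ℝ, F) p)] in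
theorem coord_mfderiv {p : N} {φ : M → N} {x : M}
    (hp : φ x ∈ (chartAt F p).source) (hφ : MDifferentiableAt 𝓘(ℝ, E) 𝓘(ℝ, F) φ x)
    (v : TangentSpace 𝓘(ℝ, E) x) :
    coord p (φ x) (mfderiv 𝓘(ℝ, E) 𝓘(ℝ, F) φ x v)
      = mvfderiv 𝓘(ℝ, E) (fun y ↦ extChartAt 𝓘(ℝ, F) p (φ y)) x v := by
  rw [coord_eq_mfderiv hp]
  exact (DFunLike.congr_fun (mfderiv_comp x (mdifferentiableAt_extChartAt hp) hφ) v).symm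

/-- The covariant derivative along `φ` in an arbitrary preferred chart. -/
theorem coord_covAlong {p : N} {φ : M → N} {σ : ∀ x, TangentSpace 𝓘(ℝ, F) (φ x)} {x : M}
    (hp : φ x ∈ (chartAt F p).source)
    (hσ : MDifferentiableAt 𝓘(ℝ, E) 𝓘(ℝ, F).tangent
      (fun y ↦ (⟨φ y, σ y⟩ : TangentBundle 𝓘(ℝ, F) N)) x) (v : TangentSpace 𝓘(ℝ, E) x) :
    coord p (φ x) (covAlong φ σ x v)
      = mvfderiv 𝓘(ℝ, E) (coordAlong p φ σ) x v
        + christoffel p (extChartAt 𝓘(ℝ, F) p (φ x))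
          (coord p (φ x) (mfderiv 𝓘(ℝ, E) 𝓘(ℝ, F) φ x v)) (coordAlong p φ σ x) := by
  have hφ : MDifferentiableAt 𝓘(ℝ, E) 𝓘(ℝ, F) φ x :=
    (mdifferentiableAt_totalSpace _ _).1 hσ |>.1
  have hq : φ x ∈ (chartAt F (φ x)).source := mem_chart_source F (φ x)
  have hA : ∀ w, coord p (φ x) w = fderiv ℝ (transition p (φ x))
      (extChartAt 𝓘(ℝ, F) (φ x) (φ x)) (coord (φ x) (φ x) w) := fun w ↦ by
    rw [fderiv_transition hp hq, coordSymm_coord hq]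
  -- The Jacobian relating the two sets of components varies with `y`; its derivative is the `D²ψ`
  -- term that matches the inhomogeneous term of `christoffel_transition`.
  have hev : coordAlong p φ σ =ᶠ[𝓝 x] fun y ↦ fderiv ℝ (transition p (φ x))
      (extChartAt 𝓘(ℝ, F) (φ x) (φ y)) (coordAlong (φ x) φ σ y) := by
    filter_upwards [hφ.continuousAt.preimage_mem_nhds ((chartAt F p).open_source.mem_nhds hp),
      hφ.continuousAt.preimage_mem_nhds ((chartAt F (φ x)).open_source.mem_nhds hq)] with y h1 h2
    rw [fderiv_transition h1 h2, coordAlong, coordAlong, coordSymm_coord h2]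
  have hκ := mdifferentiableAt_extChartAt_comp hq hφ
  have h2 := (((contDiffAt_transition hp hq).fderiv_right (m := ∞)
    (by simp)).differentiableAt (by simp)).hasFDerivAt
  have hder : mvfderiv 𝓘(ℝ, E) (coordAlong p φ σ) x v
      = fderiv ℝ (fderiv ℝ (transition p (φ x))) (extChartAt 𝓘(ℝ, F) (φ x) (φ x))
          (coord (φ x) (φ x) (mfderiv 𝓘(ℝ, E) 𝓘(ℝ, F) φ x v)) (coordAlong (φ x) φ σ x)
        + fderiv ℝ (transition p (φ x)) (extChartAt 𝓘(ℝ, F) (φ x) (φ x))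
          (mvfderiv 𝓘(ℝ, E) (coordAlong (φ x) φ σ) x v) := by
    have h3 : MDifferentiableAt 𝓘(ℝ, E) 𝓘(ℝ, F →L[ℝ] F) (fun y ↦ fderiv ℝ (transition p (φ x))
        (extChartAt 𝓘(ℝ, F) (φ x) (φ y))) x :=
      DifferentiableAt.comp_mdifferentiableAt h2.differentiableAt hκ
    rw [hev.mvfderiv_eq, mvfderiv_clm_apply h3
      (mdifferentiableAt_coordAlong hq hσ), 
      mvfderiv_comp_fderiv (f := fun y ↦ extChartAt 𝓘(ℝ, F) (φ x) (φ y)) h2 hκ, coord_mfderiv hq hφ]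
  rw [hA (covAlong φ σ x v), coord_covAlong_self, map_add, christoffel_transition hp hq, ← hA, hder,
    coordAlong, coordAlong, ← hA]
  abel

end CovAlong

/-! ### Smooth sections along a map and the rules of the connection -/

section Along

variable {E : Type*} [NormedAddCommGroup E] [NormedSpace ℝ E]
  {M : Type*} [TopologicalSpace M] [ChartedSpace E M]
  {F : Type*} [NormedAddCommGroup F] [NormedSpace ℝ F]
  {N : Type*} [TopologicalSpace N] [ChartedSpace F N] [IsManifold 𝓘(ℝ, F) ∞ N]

variable (E) in
/-- Sections along `φ` that are differentiable at `x`. -/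
def DiffAlongAt (φ : M → N) (σ : ∀ x, TangentSpace 𝓘(ℝ, F) (φ x)) (x : M) : Prop :=
  MDifferentiableAt 𝓘(ℝ, E) 𝓘(ℝ, F).tangent
    (fun y ↦ (⟨φ y, σ y⟩ : TangentBundle 𝓘(ℝ, F) N)) x

variable (E) in
/-- Sections along `φ` that are smooth on a neighbourhood of `x`. -/
def SmoothAlong (φ : M → N) (σ : ∀ x, TangentSpace 𝓘(ℝ, F) (φ x)) (x : M) : Prop :=
  ∀ᶠ z in 𝓝 x, ContMDiffAt 𝓘(ℝ, E) 𝓘(ℝ, F).tangent ∞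
    (fun y ↦ (⟨φ y, σ y⟩ : TangentBundle 𝓘(ℝ, F) N)) z

variable (E) in
/-- Real functions that are smooth on a neighbourhood of `x`. -/
def SmoothNear (f : M → ℝ) (x : M) : Prop :=
  ∀ᶠ z in 𝓝 x, ContMDiffAt 𝓘(ℝ, E) 𝓘(ℝ) ∞ f z

variable {φ : M → N} {σ ρ : ∀ x, TangentSpace 𝓘(ℝ, F) (φ x)} {x : M}

theorem coord_injective {p q : N} (hq : q ∈ (chartAt F p).source) :
    Function.Injective (coord (F := F) p q) :=
  Function.LeftInverse.injective (coordSymm_coord hq)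

theorem SmoothAlong.contMDiffAt (h : SmoothAlong E φ σ x) :
    ContMDiffAt 𝓘(ℝ, E) 𝓘(ℝ, F).tangent ∞
      (fun y ↦ (⟨φ y, σ y⟩ : TangentBundle 𝓘(ℝ, F) N)) x :=
  h.self_of_nhds

theorem SmoothAlong.diffAlongAt (h : SmoothAlong E φ σ x) : DiffAlongAt E φ σ x :=
  h.contMDiffAt.mdifferentiableAt (by simp)

theorem SmoothAlong.eventually (h : SmoothAlong E φ σ x) : ∀ᶠ y in 𝓝 x, SmoothAlong E φ σ y :=
  eventually_eventually_nhds.2 h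

theorem SmoothAlong.congr (h : SmoothAlong E φ σ x) (h' : ∀ᶠ y in 𝓝 x, ρ y = σ y) :
    SmoothAlong E φ ρ x := by
  filter_upwards [h, eventually_eventually_nhds.2 h'] with y h1 h2
  refine h1.congr_of_eventuallyEq ?_
  filter_upwards [h2] with z hz
  rw [hz]

theorem SmoothNear.mdifferentiableAt {f : M → ℝ} (h : SmoothNear E f x) :
    MDifferentiableAt 𝓘(ℝ, E) 𝓘(ℝ) f x :=
  (ContMDiffAt.mdifferentiableAt (h.self_of_nhds) (by simp))

theorem contMDiffAt_along_iff {p : N} (hp : φ x ∈ (chartAt F p).source)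
    (hφ : ContMDiffAt 𝓘(ℝ, E) 𝓘(ℝ, F) ∞ φ x) :
    ContMDiffAt 𝓘(ℝ, E) 𝓘(ℝ, F).tangent ∞
      (fun y ↦ (⟨φ y, σ y⟩ : TangentBundle 𝓘(ℝ, F) N)) x ↔
    ContMDiffAt 𝓘(ℝ, E) 𝓘(ℝ, F) ∞ (coordAlong p φ σ) x := by
  rw [(trivializationAt F (TangentSpace 𝓘(ℝ, F)) p).contMDiffAt_iff (f := fun y ↦
    (⟨φ y, σ y⟩ : TangentBundle 𝓘(ℝ, F) N)) (by simpa using hp), and_iff_right hφ]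
  refine Filter.EventuallyEq.contMDiffAt_iff ?_
  filter_upwards [hφ.continuousAt.preimage_mem_nhds
    ((chartAt F p).open_source.mem_nhds hp)] with y hy
  exact coord_eq_trivialization hy _

theorem SmoothAlong.contMDiffAt_base (h : SmoothAlong E φ σ x) :
    ContMDiffAt 𝓘(ℝ, E) 𝓘(ℝ, F) ∞ φ x :=
  (contMDiffAt_totalSpace.1 h.contMDiffAt).1

theorem SmoothAlong.add (h : SmoothAlong E φ σ x) (h' : SmoothAlong E φ ρ x) :
    SmoothAlong E φ (fun y ↦ σ y + ρ y) x := by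
  filter_upwards [h.eventually, h'.eventually] with y h1 h2
  have hφ := h1.contMDiffAt_base
  have hc := mem_chart_source F (φ y)
  rw [contMDiffAt_along_iff hc hφ]
  refine (((contMDiffAt_along_iff hc hφ).1 h1.contMDiffAt).add
    ((contMDiffAt_along_iff hc hφ).1 h2.contMDiffAt)).congr_of_eventuallyEq (.of_forall fun z ↦ ?_)
  exact map_add _ _ _

theorem SmoothAlong.smul {f : M → ℝ} (hf : SmoothNear E f x) (h : SmoothAlong E φ σ x) :
    SmoothAlong E φ (fun y ↦ f y • σ y) x := by
  filter_upwards [hf, h.eventually] with y h1 h2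
  have hφ := h2.contMDiffAt_base
  have hc := mem_chart_source F (φ y)
  rw [contMDiffAt_along_iff hc hφ]
  refine (h1.smul ((contMDiffAt_along_iff hc hφ).1 h2.contMDiffAt)).congr_of_eventuallyEq
    (.of_forall fun z ↦ ?_)
  exact map_smul _ _ _

theorem SmoothNear.const (c : ℝ) : SmoothNear E (fun _ : M ↦ c) x :=
  .of_forall fun _ ↦ contMDiffAt_const

theorem SmoothAlong.zero (hφ : ContMDiff 𝓘(ℝ, E) 𝓘(ℝ, F) ∞ φ) :
    SmoothAlong E φ (fun y ↦ (0 : TangentSpace 𝓘(ℝ, F) (φ y))) x := by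
  refine .of_forall fun y ↦ ?_
  rw [contMDiffAt_along_iff (mem_chart_source F (φ y)) (hφ y)]
  refine (contMDiffAt_const (c := (0 : F))).congr_of_eventuallyEq (.of_forall fun z ↦ ?_)
  exact map_zero _

theorem SmoothAlong.sum (hφ : ContMDiff 𝓘(ℝ, E) 𝓘(ℝ, F) ∞ φ) {ι : Type*} (s : Finset ι)
    {τ : ι → ∀ x, TangentSpace 𝓘(ℝ, F) (φ x)} (h : ∀ i, SmoothAlong E φ (τ i) x) :
    SmoothAlong E φ (fun y ↦ ∑ i ∈ s, τ i y) x := by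
  classical
  induction s using Finset.induction_on with
  | empty => simpa using SmoothAlong.zero hφ
  | insert i s hi ih => simpa only [Finset.sum_insert hi] using (h i).add ih

theorem SmoothAlong.neg (h : SmoothAlong E φ σ x) : SmoothAlong E φ (fun y ↦ -σ y) x := by
  simpa using SmoothAlong.smul (SmoothNear.const (-1)) h

theorem SmoothAlong.sub (h : SmoothAlong E φ σ x) (h' : SmoothAlong E φ ρ x) :
    SmoothAlong E φ (fun y ↦ σ y - ρ y) x := by
  simpa only [sub_eq_add_neg] using h.add h'.neg

theorem SmoothAlong.comp {G : Type*} [NormedAddCommGroup G] [NormedSpace ℝ G]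
    {P : Type*} [TopologicalSpace P] [ChartedSpace G P] {ψ : P → M} {z : P}
    (h : SmoothAlong E φ σ (ψ z)) (hψ : ContMDiff 𝓘(ℝ, G) 𝓘(ℝ, E) ∞ ψ) :
    SmoothAlong G (fun w ↦ φ (ψ w)) (fun w ↦ σ (ψ w)) z := by
  filter_upwards [hψ.continuous.continuousAt.eventually h] with y hy
  exact ContMDiffAt.comp y hy (hψ y)

theorem smoothAlong_extend (p : N) (v : TangentSpace 𝓘(ℝ, F) p) :
    SmoothAlong F (fun q : N ↦ q) (FiberBundle.extend F v) p := by
  filter_upwards [(chartAt F p).open_source.mem_nhds (mem_chart_source F p)] with y hy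
  have hid : ContMDiffAt 𝓘(ℝ, F) 𝓘(ℝ, F) ∞ (fun q : N ↦ q) y := contMDiffAt_id
  rw [contMDiffAt_along_iff hy hid]
  refine (contMDiffAt_const (c := coord p p v)).congr_of_eventuallyEq ?_
  filter_upwards [(chartAt F p).open_source.mem_nhds hy] with z hz
  exact coord_extend hz v

theorem DiffAlongAt.coordAlong {p : N} (hp : φ x ∈ (chartAt F p).source)
    (hσ : DiffAlongAt E φ σ x) : MDifferentiableAt 𝓘(ℝ, E) 𝓘(ℝ, F) (coordAlong p φ σ) x :=
  mdifferentiableAt_coordAlong hp hσ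

theorem DiffAlongAt.base (hσ : DiffAlongAt E φ σ x) :
    MDifferentiableAt 𝓘(ℝ, E) 𝓘(ℝ, F) φ x :=
  (mdifferentiableAt_totalSpace _ _).1 hσ |>.1

/-- The directional derivative of a smooth function along a smooth vector field is smooth. -/
theorem contMDiffAt_mvfderiv {G : Type*} [NormedAddCommGroup G] [NormedSpace ℝ G]
    [IsManifold 𝓘(ℝ, E) ∞ M] {f : M → G} {V : ∀ x : M, TangentSpace 𝓘(ℝ, E) x}
    (hf : ContMDiffAt 𝓘(ℝ, E) 𝓘(ℝ, G) ∞ f x)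
    (hV : SmoothAlong E (fun y : M ↦ y) V x) :
    ContMDiffAt 𝓘(ℝ, E) 𝓘(ℝ, G) ∞ (fun y ↦ mvfderiv 𝓘(ℝ, E) f y (V y)) x := by
  have h1 := hf.mfderiv_const (m := ∞) (by simp)
  have hid : ContMDiffAt 𝓘(ℝ, E) 𝓘(ℝ, E) ∞ (fun y : M ↦ y) x := contMDiffAt_id
  have h2 := (contMDiffAt_along_iff (mem_chart_source E x) hid).1 hV.contMDiffAt
  refine (h1.clm_apply h2).congr_of_eventuallyEq ?_
  filter_upwards [(chartAt E x).open_source.mem_nhds (mem_chart_source E x)] with y hy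
  have h3 := inTangentCoordinates_eq (I := 𝓘(ℝ, E)) (I' := 𝓘(ℝ, G)) id f
    (mvfderiv 𝓘(ℝ, E) f) (x₀ := x) (x := y) hy (Set.mem_univ _)
  refine Eq.trans ?_ (DFunLike.congr_fun h3 _).symm
  rw [TangentBundle.coordChange_model_space]
  have h4 : coordSymm x y (coordAlong x (fun y : M ↦ y) V y) = V y := coordSymm_coord hy _
  rw [coordSymm, TangentBundle.symmL_trivializationAt_eq_core hy] at h4
  exact congrArg (mvfderiv 𝓘(ℝ, E) f y) h4.symm

variable [RiemannianBundle (fun p : N ↦ TangentSpace 𝓘(ℝ, F) p)]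

theorem covAlong_congr (h : ∀ᶠ y in 𝓝 x, σ y = ρ y) (v : TangentSpace 𝓘(ℝ, E) x) :
    covAlong φ σ x v = covAlong φ ρ x v := by
  refine coord_injective (mem_chart_source F (φ x)) ?_
  have h' : coordAlong (φ x) φ σ =ᶠ[𝓝 x] coordAlong (φ x) φ ρ := by
    filter_upwards [h] with y hy
    rw [coordAlong, hy, coordAlong]
  rw [coord_covAlong_self, coord_covAlong_self, h'.mvfderiv_eq, h'.self_of_nhds]

/-- The chain rule for the connection along a map. -/
theorem covAlong_comp {G : Type*} [NormedAddCommGroup G] [NormedSpace ℝ G]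
    {P : Type*} [TopologicalSpace P] [ChartedSpace G P] {ψ : P → M} {z : P}
    (hψ : MDifferentiableAt 𝓘(ℝ, G) 𝓘(ℝ, E) ψ z) (hσ : DiffAlongAt E φ σ (ψ z))
    (v : TangentSpace 𝓘(ℝ, G) z) :
    covAlong (fun w ↦ φ (ψ w)) (fun w ↦ σ (ψ w)) z v
      = covAlong φ σ (ψ z) (mfderiv 𝓘(ℝ, G) 𝓘(ℝ, E) ψ z v) := by
  refine coord_injective (mem_chart_source F (φ (ψ z))) ?_
  refine (coord_covAlong_self (fun w ↦ φ (ψ w)) (fun w ↦ σ (ψ w)) z v).trans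
    (Eq.trans ?_ (coord_covAlong_self φ σ (ψ z) _).symm)
  have h1 : mfderiv 𝓘(ℝ, G) 𝓘(ℝ, F) (fun w ↦ φ (ψ w)) z v
      = mfderiv 𝓘(ℝ, E) 𝓘(ℝ, F) φ (ψ z) (mfderiv 𝓘(ℝ, G) 𝓘(ℝ, E) ψ z v) :=
    mfderiv_comp_apply z hσ.base hψ v
  have h2 : mvfderiv 𝓘(ℝ, G) (fun w ↦ coordAlong (φ (ψ z)) φ σ (ψ w)) z v
      = mvfderiv 𝓘(ℝ, E) (coordAlong (φ (ψ z)) φ σ) (ψ z) (mfderiv 𝓘(ℝ, G) 𝓘(ℝ, E) ψ z v) :=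
    mfderiv_comp_apply z (hσ.coordAlong (mem_chart_source F _)) hψ v
  rw [h1, ← h2]
  rfl

variable [FiniteDimensional ℝ F]
  [IsContMDiffRiemannianBundle 𝓘(ℝ, F) ∞ F (fun p : N ↦ TangentSpace 𝓘(ℝ, F) p)]

theorem covAlong_add (hσ : DiffAlongAt E φ σ x) (hρ : DiffAlongAt E φ ρ x)
    (v : TangentSpace 𝓘(ℝ, E) x) :
    covAlong φ (fun y ↦ σ y + ρ y) x v = covAlong φ σ x v + covAlong φ ρ x v := by
  have hc := mem_chart_source F (φ x)
  refine coord_injective hc ?_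
  have h : coordAlong (φ x) φ (fun y ↦ σ y + ρ y) = coordAlong (φ x) φ σ + coordAlong (φ x) φ ρ :=
    funext fun y ↦ map_add _ _ _
  rw [map_add, coord_covAlong_self, coord_covAlong_self, coord_covAlong_self, h,
    mvfderiv_add (hσ.coordAlong hc) (hρ.coordAlong hc), Pi.add_apply,
    christoffel_add_right (extChartAt_mem_target hc), _root_.add_apply]
  abel

theorem covAlong_smul {f : M → ℝ} (hf : MDifferentiableAt 𝓘(ℝ, E) 𝓘(ℝ) f x)
    (hσ : DiffAlongAt E φ σ x) (v : TangentSpace 𝓘(ℝ, E) x) :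
    covAlong φ (fun y ↦ f y • σ y) x v
      = mvfderiv 𝓘(ℝ, E) f x v • σ x + f x • covAlong φ σ x v := by
  have hc := mem_chart_source F (φ x)
  refine coord_injective hc ?_
  have h : coordAlong (φ x) φ (fun y ↦ f y • σ y) = f • coordAlong (φ x) φ σ :=
    funext fun y ↦ map_smul _ _ _
  rw [map_add, map_smul, map_smul, coord_covAlong_self, coord_covAlong_self, h,
    mvfderiv_smul hf (hσ.coordAlong hc), Pi.smul_apply',
    christoffel_smul_right (extChartAt_mem_target hc), _root_.add_apply, _root_.smul_apply,
    ContinuousLinearMap.smulRight_apply, smul_add]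
  change _ = _ • coordAlong (φ x) φ σ x + _
  abel

/-- The covariant derivative as a linear map in the direction. -/
theorem covAlong_add_vec (φ : M → N) (σ : ∀ x, TangentSpace 𝓘(ℝ, F) (φ x)) (x : M)
    (v w : TangentSpace 𝓘(ℝ, E) x) :
    covAlong φ σ x (v + w) = covAlong φ σ x v + covAlong φ σ x w := by
  have hc := mem_chart_source F (φ x)
  refine coord_injective hc ?_
  rw [map_add, coord_covAlong_self, coord_covAlong_self, coord_covAlong_self, map_add, map_add,
    map_add, christoffel_add_left (extChartAt_mem_target hc)]
  abel

theorem covAlong_smul_vec (φ : M → N) (σ : ∀ x, TangentSpace 𝓘(ℝ, F) (φ x)) (x : M)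
    (c : ℝ) (v : TangentSpace 𝓘(ℝ, E) x) :
    covAlong φ σ x (c • v) = c • covAlong φ σ x v := by
  have hc := mem_chart_source F (φ x)
  refine coord_injective hc ?_
  rw [map_smul, coord_covAlong_self, coord_covAlong_self, map_smul, map_smul, map_smul,
    christoffel_smul_left (extChartAt_mem_target hc), smul_add]

/-- The connection along a map is compatible with the metric. -/
theorem mvfderiv_inner (hσ : DiffAlongAt E φ σ x) (hρ : DiffAlongAt E φ ρ x)
    (v : TangentSpace 𝓘(ℝ, E) x) :
    mvfderiv 𝓘(ℝ, E) (fun y ↦ (inner ℝ (σ y) (ρ y) : ℝ)) x v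
      = inner ℝ (covAlong φ σ x v) (ρ x) + inner ℝ (σ x) (covAlong φ ρ x v) := by
  have hc := mem_chart_source F (φ x)
  have hz := extChartAt_mem_target hc
  have hκ := mdifferentiableAt_extChartAt_comp hc hσ.base
  -- In a fixed chart the product rule has three terms; the one differentiating the metric supplies
  -- both Christoffel terms through `fderiv_metricInChart`.
  have hev : (fun y ↦ (inner ℝ (σ y) (ρ y) : ℝ)) =ᶠ[𝓝 x] fun y ↦
      metricInChart (φ x) (extChartAt 𝓘(ℝ, F) (φ x) (φ y)) (coordAlong (φ x) φ σ y)
        (coordAlong (φ x) φ ρ y) := by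
    filter_upwards [hσ.base.continuousAt.preimage_mem_nhds
      ((chartAt F (φ x)).open_source.mem_nhds hc)] with y hy
    exact inner_eq_metricInChart hy _ _
  have h1 : MDifferentiableAt 𝓘(ℝ, E) 𝓘(ℝ, F →L[ℝ] F →L[ℝ] ℝ)
      (fun y ↦ metricInChart (φ x) (extChartAt 𝓘(ℝ, F) (φ x) (φ y))) x :=
    DifferentiableAt.comp_mdifferentiableAt (g := metricInChart (φ x))
      (f := fun y ↦ extChartAt 𝓘(ℝ, F) (φ x) (φ y)) (differentiableAt_metricInChart hz) hκ
  rw [hev.mvfderiv_eq, mvfderiv_clm_apply (h1.clm_apply (hσ.coordAlong hc)) (hρ.coordAlong hc),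
    mvfderiv_clm_apply h1 (hσ.coordAlong hc),
    mvfderiv_comp_fderiv (f := fun y ↦ extChartAt 𝓘(ℝ, F) (φ x) (φ y))
      (differentiableAt_metricInChart hz).hasFDerivAt hκ, inner_eq_metricInChart hc,
    inner_eq_metricInChart hc, coord_covAlong_self, coord_covAlong_self, _root_.add_apply,
    fderiv_metricInChart hz, map_add, map_add, _root_.add_apply, coord_mfderiv hc hσ.base]
  simp only [coordAlong]
  ring

/-- The covariant derivative of a smooth section along a smooth vector field is smooth. -/
theorem SmoothAlong.covAlong [IsManifold 𝓘(ℝ, E) ∞ M] {V : ∀ x : M, TangentSpace 𝓘(ℝ, E) x}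
    (hσ : SmoothAlong E φ σ x) (hV : SmoothAlong E (fun y : M ↦ y) V x) :
    SmoothAlong E φ (fun y ↦ covAlong φ σ y (V y)) x := by
  filter_upwards [hσ.eventually, hV.eventually] with x hσ hV
  have hc := mem_chart_source F (φ x)
  have hφ := hσ.contMDiffAt_base
  rw [contMDiffAt_along_iff hc hφ]
  have hκ : ContMDiffAt 𝓘(ℝ, E) 𝓘(ℝ, F) ∞ (fun y ↦ extChartAt 𝓘(ℝ, F) (φ x) (φ y)) x :=
    (contMDiffAt_extChartAt' hc).comp x hφ
  have hrep := (contMDiffAt_along_iff hc hφ).1 hσ.contMDiffAt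
  have h1 := contMDiffAt_mvfderiv hrep hV
  have h2 := contMDiffAt_mvfderiv hκ hV
  have h3 : ContDiffAt ℝ ∞ (fun w : F × F × F ↦ christoffel (φ x) w.1 w.2.1 w.2.2)
      (extChartAt 𝓘(ℝ, F) (φ x) (φ x),
        mvfderiv 𝓘(ℝ, E) (fun y ↦ extChartAt 𝓘(ℝ, F) (φ x) (φ y)) x (V x),
        coordAlong (φ x) φ σ x) :=
    contDiffAt_christoffel (extChartAt_mem_target hc) (by fun_prop) (by fun_prop) (by fun_prop)
  have h4 := ContDiffAt.comp_contMDiffAt (f := fun y ↦ (extChartAt 𝓘(ℝ, F) (φ x) (φ y),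
    mvfderiv 𝓘(ℝ, E) (fun y ↦ extChartAt 𝓘(ℝ, F) (φ x) (φ y)) y (V y),
    coordAlong (φ x) φ σ y)) h3 (hκ.prodMk_space (h2.prodMk_space hrep))
  refine (h1.add h4).congr_of_eventuallyEq ?_
  -- At a nearby `y` the connection is defined in the chart at `φ y`; `coord_covAlong` re-expresses
  -- it in the chart at `φ x`.
  filter_upwards [hσ.eventually, hφ.continuousAt.preimage_mem_nhds
    ((chartAt F (φ x)).open_source.mem_nhds hc)] with y hy hy'
  refine (coord_covAlong hy' hy.diffAlongAt _).trans ?_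
  rw [coord_mfderiv hy' hy.diffAlongAt.base]
  rfl

end Along

/-! ### Tensoriality criterion -/

section Tensoriality

variable {E : Type*} [NormedAddCommGroup E] [NormedSpace ℝ E]
  {M : Type*} [TopologicalSpace M] [ChartedSpace E M]
  {G : Type*} [NormedAddCommGroup G] [NormedSpace ℝ G] [FiniteDimensional ℝ G]
  {P : Type*} [TopologicalSpace P] [ChartedSpace G P] [IsManifold 𝓘(ℝ, G) ∞ P]

/-- A basis of `T_p P`. -/
def frameVec (p : P) (i : Fin (Module.finrank ℝ G)) : TangentSpace 𝓘(ℝ, G) p :=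
  coordSymm p p (Module.finBasis ℝ G i)

/-- The components of a section along `ψ` in the coordinate frame around `ψ x`. -/
def frameCoeff (ψ : M → P) (τ : ∀ y, TangentSpace 𝓘(ℝ, G) (ψ y)) (x : M)
    (i : Fin (Module.finrank ℝ G)) (y : M) : ℝ :=
  (Module.finBasis ℝ G).coord i (coordAlong (ψ x) ψ τ y)

variable {ψ : M → P} {τ ρ : ∀ y, TangentSpace 𝓘(ℝ, G) (ψ y)} {x : M}

theorem eventually_eq_sum_frame (hψ : ContinuousAt ψ x) :
    ∀ᶠ y in 𝓝 x, τ y = ∑ i, frameCoeff ψ τ x i y •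
      FiberBundle.extend G (frameVec (ψ x) i) (ψ y) := by
  have hc := mem_chart_source G (ψ x)
  filter_upwards [hψ.preimage_mem_nhds ((chartAt G (ψ x)).open_source.mem_nhds hc)] with y hy
  refine coord_injective hy ?_
  simp only [map_sum, map_smul, coord_extend hy, frameVec, coord_coordSymm hc, frameCoeff,
    Module.Basis.coord_apply]
  exact ((Module.finBasis ℝ G).sum_repr _).symm

theorem smoothNear_frameCoeff (hτ : SmoothAlong E ψ τ x) (i : Fin (Module.finrank ℝ G)) :
    SmoothNear E (frameCoeff ψ τ x i) x := by
  have hc := mem_chart_source G (ψ x)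
  filter_upwards [hτ.eventually, hτ.contMDiffAt_base.continuousAt.preimage_mem_nhds
    ((chartAt G (ψ x)).open_source.mem_nhds hc)] with y hy hy'
  have h := (contMDiffAt_along_iff hy' hy.contMDiffAt_base).1 hy.contMDiffAt
  have hl : ContDiffAt ℝ ∞ (LinearMap.toContinuousLinearMap ((Module.finBasis ℝ G).coord i))
    (coordAlong (ψ x) ψ τ y) := ContinuousLinearMap.contDiff _ |>.contDiffAt
  exact hl.comp_contMDiffAt h

/-- An operator on sections along `ψ` that is linear over smooth functions at `x` depends only on
the value of the section at `x`. -/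
theorem eq_of_tensorial {A : Type*} [AddCommGroup A] [Module ℝ A]
    (hψ : ContMDiff 𝓘(ℝ, E) 𝓘(ℝ, G) ∞ ψ)
    (D : (∀ y, TangentSpace 𝓘(ℝ, G) (ψ y)) → A)
    (hcongr : ∀ τ ρ, SmoothAlong E ψ τ x → SmoothAlong E ψ ρ x →
      (∀ᶠ y in 𝓝 x, τ y = ρ y) → D τ = D ρ)
    (hadd : ∀ τ ρ, SmoothAlong E ψ τ x → SmoothAlong E ψ ρ x →
      D (fun y ↦ τ y + ρ y) = D τ + D ρ)
    (hsmul : ∀ f τ, SmoothNear E f x → SmoothAlong E ψ τ x → D (fun y ↦ f y • τ y) = f x • D τ)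
    (hτ : SmoothAlong E ψ τ x) (hρ : SmoothAlong E ψ ρ x) (h : τ x = ρ x) : D τ = D ρ := by
  classical
  set W : Fin (Module.finrank ℝ G) → ∀ y, TangentSpace 𝓘(ℝ, G) (ψ y) :=
    fun i y ↦ FiberBundle.extend G (frameVec (ψ x) i) (ψ y) with hW
  have hWs : ∀ i, SmoothAlong E ψ (W i) x := fun i ↦ (smoothAlong_extend _ _).comp hψ
  have hzero : D (fun y ↦ (0 : TangentSpace 𝓘(ℝ, G) (ψ y))) = 0 := by
    have := hsmul (fun _ ↦ 0) _ (SmoothNear.const 0) (SmoothAlong.zero (x := x) hψ)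
    simpa using this
  -- Expansion in the coordinate frame near `x`: the right-hand side sees `τ` only through its
  -- components at `x`.
  have key : ∀ τ, SmoothAlong E ψ τ x → D τ = ∑ i, frameCoeff ψ τ x i x • D (W i) := by
    intro τ hτ
    have hs : ∀ i, SmoothAlong E ψ (fun y ↦ frameCoeff ψ τ x i y • W i y) x := fun i ↦
      (hWs i).smul (smoothNear_frameCoeff hτ i)
    rw [hcongr τ _ hτ (SmoothAlong.sum hψ Finset.univ hs)
      (eventually_eq_sum_frame hψ.continuous.continuousAt)]
    have hsum : ∀ s : Finset (Fin (Module.finrank ℝ G)),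
        D (fun y ↦ ∑ i ∈ s, frameCoeff ψ τ x i y • W i y)
          = ∑ i ∈ s, frameCoeff ψ τ x i x • D (W i) := by
      intro s
      induction s using Finset.induction_on with
      | empty => simpa using hzero
      | insert i s hi ih =>
        simp only [Finset.sum_insert hi]
        rw [hadd _ _ (hs i) (SmoothAlong.sum hψ s hs), ih,
          hsmul _ _ (smoothNear_frameCoeff hτ i) (hWs i)]
    exact hsum _
  rw [key τ hτ, key ρ hρ]
  simp only [frameCoeff, coordAlong, h]

end Tensoriality

/-! ### Covariant derivatives of fields of linear maps -/

section Hom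

variable {E : Type*} [NormedAddCommGroup E] [NormedSpace ℝ E]
  {M : Type*} [TopologicalSpace M] [ChartedSpace E M]
  {G : Type*} [NormedAddCommGroup G] [NormedSpace ℝ G] [FiniteDimensional ℝ G]
  {P : Type*} [TopologicalSpace P] [ChartedSpace G P] [IsManifold 𝓘(ℝ, G) ∞ P]
  [RiemannianBundle (fun p : P ↦ TangentSpace 𝓘(ℝ, G) p)]
  [IsContMDiffRiemannianBundle 𝓘(ℝ, G) ∞ G (fun p : P ↦ TangentSpace 𝓘(ℝ, G) p)]
  {F : Type*} [NormedAddCommGroup F] [NormedSpace ℝ F] [FiniteDimensional ℝ F]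
  {N : Type*} [TopologicalSpace N] [ChartedSpace F N] [IsManifold 𝓘(ℝ, F) ∞ N]
  [RiemannianBundle (fun p : N ↦ TangentSpace 𝓘(ℝ, F) p)]
  [IsContMDiffRiemannianBundle 𝓘(ℝ, F) ∞ F (fun p : N ↦ TangentSpace 𝓘(ℝ, F) p)]

/-- The covariant derivative of a field `H` of linear maps is tensorial. -/
theorem covAlong_hom_sub {ψ : M → P} {φ : M → N} (hψ : ContMDiff 𝓘(ℝ, E) 𝓘(ℝ, G) ∞ ψ)
    {H : ∀ y, TangentSpace 𝓘(ℝ, G) (ψ y) → TangentSpace 𝓘(ℝ, F) (φ y)}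
    (hH : ∀ y, IsLinearMap ℝ (H y)) {x : M}
    (hHs : ∀ τ, SmoothAlong E ψ τ x → SmoothAlong E φ (fun y ↦ H y (τ y)) x)
    {τ ρ : ∀ y, TangentSpace 𝓘(ℝ, G) (ψ y)} (hτ : SmoothAlong E ψ τ x)
    (hρ : SmoothAlong E ψ ρ x) (h : τ x = ρ x) (u : TangentSpace 𝓘(ℝ, E) x) :
    covAlong φ (fun y ↦ H y (τ y)) x u - H x (covAlong ψ τ x u)
      = covAlong φ (fun y ↦ H y (ρ y)) x u - H x (covAlong ψ ρ x u) := by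
  refine eq_of_tensorial (x := x) hψ
    (fun τ ↦ covAlong φ (fun y ↦ H y (τ y)) x u - H x (covAlong ψ τ x u)) ?_ ?_ ?_ hτ hρ h
  · intro τ ρ _ _ h
    have h' : ∀ᶠ y in 𝓝 x, H y (τ y) = H y (ρ y) := by
      filter_upwards [h] with y hy
      rw [hy]
    simp only [covAlong_congr h, covAlong_congr h']
  · intro τ ρ hτ hρ
    simp only [(hH _).map_add]
    rw [covAlong_add hτ.diffAlongAt hρ.diffAlongAt,
      covAlong_add (hHs τ hτ).diffAlongAt (hHs ρ hρ).diffAlongAt, (hH _).map_add]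
    abel
  -- Both covariant derivatives produce the Leibniz term `df(u) • H τ`, and the difference loses it.
  · intro f τ hf hτ
    simp only [(hH _).map_smul]
    rw [covAlong_smul hf.mdifferentiableAt hτ.diffAlongAt,
      covAlong_smul hf.mdifferentiableAt (hHs τ hτ).diffAlongAt, (hH _).map_add, (hH _).map_smul,
      (hH _).map_smul, smul_sub]
    abel

end Hom

/-! ### Second covariant derivatives and chain rules -/

section SecondDerivative

variable {E : Type*} [NormedAddCommGroup E] [NormedSpace ℝ E] [FiniteDimensional ℝ E]
  {M : Type*} [TopologicalSpace M] [ChartedSpace E M] [IsManifold 𝓘(ℝ, E) ∞ M]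
  [RiemannianBundle (fun x : M ↦ TangentSpace 𝓘(ℝ, E) x)]
  [IsContMDiffRiemannianBundle 𝓘(ℝ, E) ∞ E (fun x : M ↦ TangentSpace 𝓘(ℝ, E) x)]
  {F : Type*} [NormedAddCommGroup F] [NormedSpace ℝ F] [FiniteDimensional ℝ F]
  {N : Type*} [TopologicalSpace N] [ChartedSpace F N] [IsManifold 𝓘(ℝ, F) ∞ N]
  [RiemannianBundle (fun p : N ↦ TangentSpace 𝓘(ℝ, F) p)]
  [IsContMDiffRiemannianBundle 𝓘(ℝ, F) ∞ F (fun p : N ↦ TangentSpace 𝓘(ℝ, F) p)]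
  {φ : M → N} {σ : ∀ x, TangentSpace 𝓘(ℝ, F) (φ x)} {x : M}
  {V : ∀ x : M, TangentSpace 𝓘(ℝ, E) x} {X : ∀ p : N, TangentSpace 𝓘(ℝ, F) p}

theorem isLinearMap_covAlong (φ : M → N) (σ : ∀ x, TangentSpace 𝓘(ℝ, F) (φ x)) (x : M) :
    IsLinearMap ℝ (covAlong (E := E) φ σ x) :=
  ⟨covAlong_add_vec φ σ x, covAlong_smul_vec φ σ x⟩

theorem isLinearMap_leviCivita (X : ∀ p : N, TangentSpace 𝓘(ℝ, F) p) (p : N) :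
    IsLinearMap ℝ (leviCivita X p) :=
  isLinearMap_covAlong (fun q : N ↦ q) X p

theorem isLinearMap_dmap (φ : M → N) (x : M) :
    IsLinearMap ℝ (dmap (E := E) (F := F) φ x) :=
  ⟨map_add (mfderiv 𝓘(ℝ, E) 𝓘(ℝ, F) φ x), map_smul (mfderiv 𝓘(ℝ, E) 𝓘(ℝ, F) φ x)⟩

theorem SmoothAlong.dmap (hφ : ContMDiff 𝓘(ℝ, E) 𝓘(ℝ, F) ∞ φ)
    (hV : SmoothAlong E (fun y : M ↦ y) V x) :
    SmoothAlong E φ (fun y ↦ Polyharmonic.dmap (F := F) φ y (V y)) x := by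
  have h := hφ.contMDiff_tangentMap (m := ∞) (by simp)
  filter_upwards [hV] with y hy
  exact ContMDiffAt.comp y (h _) hy

/-- `covAlong_hom_sub` for the linear maps `v ↦ ∇̄_v σ`: the constant-coefficient extension in
`covAlong₂` may be replaced by any smooth field with the same value at `x`. The next lemma is the
same for `dφ`. -/
theorem covAlong_covAlong (hσ : SmoothAlong E φ σ x)
    (hV : SmoothAlong E (fun y : M ↦ y) V x) (u : TangentSpace 𝓘(ℝ, E) x) :
    covAlong φ (fun y ↦ covAlong φ σ y (V y)) x u
      = covAlong₂ φ σ x u (V x) + covAlong φ σ x (leviCivita V x u) := by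
  rw [← sub_eq_iff_eq_add]
  exact covAlong_hom_sub (ψ := fun y : M ↦ y) contMDiff_id (isLinearMap_covAlong φ σ)
    (fun τ hτ ↦ hσ.covAlong hτ) hV (smoothAlong_extend x (V x))
    (FiberBundle.extend_apply_self E (V x)).symm u

theorem covAlong_dmap (hφ : ContMDiff 𝓘(ℝ, E) 𝓘(ℝ, F) ∞ φ)
    (hV : SmoothAlong E (fun y : M ↦ y) V x) (u : TangentSpace 𝓘(ℝ, E) x) :
    covAlong (F := F) φ (fun y ↦ dmap (F := F) φ y (V y)) x u
      = covDmap (F := F) φ x u (V x) + dmap (F := F) φ x (leviCivita V x u) := by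
  rw [← sub_eq_iff_eq_add]
  exact covAlong_hom_sub (ψ := fun y : M ↦ y) contMDiff_id (isLinearMap_dmap φ)
    (fun τ hτ ↦ hτ.dmap hφ) hV (smoothAlong_extend x (V x))
    (FiberBundle.extend_apply_self E (V x)).symm u

theorem IsSmoothVectorField.smoothAlong (hX : IsSmoothVectorField X) (p : N) :
    SmoothAlong F (fun q : N ↦ q) X p :=
  .of_forall hX

theorem SmoothAlong.leviCivita_comp (hφ : ContMDiff 𝓘(ℝ, E) 𝓘(ℝ, F) ∞ φ)
    (hX : SmoothAlong F (fun q : N ↦ q) X (φ x)) (hσ : SmoothAlong E φ σ x) :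
    SmoothAlong E φ (fun y ↦ leviCivita X (φ y) (σ y)) x := by
  -- A section along `φ` need not come from a field on `N`, so `σ` is expanded in pulled-back
  -- coordinate fields, for which smoothness follows by composition.
  have h : ∀ i, SmoothAlong E φ (fun y ↦ leviCivita X (φ y)
      (FiberBundle.extend F (frameVec (φ x) i) (φ y))) x := fun i ↦
    (hX.covAlong (smoothAlong_extend (φ x) (frameVec (φ x) i))).comp hφ
  refine (SmoothAlong.sum hφ Finset.univ fun i ↦
    (h i).smul (smoothNear_frameCoeff hσ i)).congr ?_
  filter_upwards [eventually_eq_sum_frame (τ := σ) hφ.continuous.continuousAt] with y hy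
  have := map_sum ((isLinearMap_leviCivita X (φ y)).mk' _) (fun i ↦ frameCoeff φ σ x i y •
      FiberBundle.extend F (frameVec (φ x) i) (φ y)) Finset.univ
  rw [← hy] at this
  refine this.trans (Finset.sum_congr rfl fun i _ ↦ ?_)
  exact (isLinearMap_leviCivita X (φ y)).map_smul _ _

/-- The derivative of `∇_σ X` along `φ`. -/
theorem covAlong_leviCivita (hφ : ContMDiff 𝓘(ℝ, E) 𝓘(ℝ, F) ∞ φ)
    (hX : SmoothAlong F (fun q : N ↦ q) X (φ x)) (hσ : SmoothAlong E φ σ x)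
    (u : TangentSpace 𝓘(ℝ, E) x) :
    covAlong φ (fun y ↦ leviCivita X (φ y) (σ y)) x u
      = covAlong₂ (fun q : N ↦ q) X (φ x) (dmap (F := F) φ x u) (σ x)
        + leviCivita X (φ x) (covAlong φ σ x u) := by
  rw [← sub_eq_iff_eq_add]
  have hW := smoothAlong_extend (φ x) (σ x)
  have hφx := (hφ x).mdifferentiableAt (by simp)
  -- Tensoriality allows `σ` to be replaced by the pullback of a field on `N`; the chain rule then
  -- applies to both terms.
  refine (covAlong_hom_sub (ψ := φ) hφ (fun y ↦ isLinearMap_leviCivita X (φ y))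
    (fun τ hτ ↦ SmoothAlong.leviCivita_comp hφ hX hτ) hσ (hW.comp hφ)
    (FiberBundle.extend_apply_self F (σ x)).symm u).trans ?_
  refine congrArg₂ (· - ·) ?_ ?_
  · exact covAlong_comp (φ := fun q : N ↦ q)
      (σ := fun q ↦ leviCivita X q (FiberBundle.extend F (σ x) q)) hφx
      (hX.covAlong hW).diffAlongAt u
  · exact congrArg (leviCivita X (φ x)) (covAlong_comp (φ := fun q : N ↦ q)
      (σ := FiberBundle.extend F (σ x)) hφx hW.diffAlongAt u)

theorem leviCivita_add {X Y : ∀ p : N, TangentSpace 𝓘(ℝ, F) p} {p : N}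
    (hX : SmoothAlong F (fun q : N ↦ q) X p) (hY : SmoothAlong F (fun q : N ↦ q) Y p)
    (u : TangentSpace 𝓘(ℝ, F) p) :
    leviCivita (fun q ↦ X q + Y q) p u = leviCivita X p u + leviCivita Y p u :=
  covAlong_add hX.diffAlongAt hY.diffAlongAt u

theorem leviCivita_const_smul {X : ∀ p : N, TangentSpace 𝓘(ℝ, F) p} {p : N}
    (hX : SmoothAlong F (fun q : N ↦ q) X p) (c : ℝ) (u : TangentSpace 𝓘(ℝ, F) p) :
    leviCivita (fun q ↦ c • X q) p u = c • leviCivita X p u := by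
  refine (covAlong_smul (SmoothNear.const c).mdifferentiableAt hX.diffAlongAt u).trans ?_
  rw [mvfderiv_const]
  simp [leviCivita]

/-- The chain rule for the second covariant derivative of a vector field along `φ`. -/
theorem covAlong₂_comp (hφ : ContMDiff 𝓘(ℝ, E) 𝓘(ℝ, F) ∞ φ)
    (hX : SmoothAlong F (fun q : N ↦ q) X (φ x)) (u v : TangentSpace 𝓘(ℝ, E) x) :
    covAlong₂ φ (fun y ↦ X (φ y)) x u v
      = covAlong₂ (fun q : N ↦ q) X (φ x) (dmap (F := F) φ x u) (dmap (F := F) φ x v)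
        + leviCivita X (φ x) (covDmap (F := F) φ x u v) := by
  have hV := smoothAlong_extend x v
  have hchain : ∀ᶠ y in 𝓝 x, ∀ w : TangentSpace 𝓘(ℝ, E) y, covAlong φ (fun y ↦ X (φ y)) y w
      = leviCivita X (φ y) (dmap (F := F) φ y w) := by
    filter_upwards [hφ.continuous.continuousAt.eventually hX.eventually] with y hy w
    exact covAlong_comp (φ := fun q : N ↦ q) (σ := X) ((hφ y).mdifferentiableAt (by simp))
      hy.diffAlongAt w
  rw [covAlong₂, covAlong_congr (hchain.mono fun y hy ↦ hy (FiberBundle.extend E v y)),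
    hchain.self_of_nhds, covAlong_leviCivita hφ hX (hV.dmap hφ), covAlong_dmap hφ hV,
    FiberBundle.extend_apply_self, (isLinearMap_leviCivita X (φ x)).map_add]
  abel

/-- `covAlong_covAlong` is applied to the sum of the extensions of `v` and `w`, a smooth field with
value `v + w` at `x`. -/
theorem covAlong₂_add_right (hσ : SmoothAlong E φ σ x) (u v w : TangentSpace 𝓘(ℝ, E) x) :
    covAlong₂ φ σ x u (v + w) = covAlong₂ φ σ x u v + covAlong₂ φ σ x u w := by
  have hv := smoothAlong_extend x v
  have hw := smoothAlong_extend x w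
  have h := covAlong_covAlong hσ (hv.add hw) u
  simp only [FiberBundle.extend_apply_self, (isLinearMap_covAlong φ σ _).map_add] at h
  rw [covAlong_add (hσ.covAlong hv).diffAlongAt (hσ.covAlong hw).diffAlongAt,
    leviCivita_add hv hw, (isLinearMap_covAlong φ σ _).map_add, ← sub_eq_iff_eq_add] at h
  rw [← h, covAlong₂, covAlong₂]
  abel

theorem covAlong₂_smul_right (hσ : SmoothAlong E φ σ x) (c : ℝ) (u v : TangentSpace 𝓘(ℝ, E) x) :
    covAlong₂ φ σ x u (c • v) = c • covAlong₂ φ σ x u v := by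
  have hv := smoothAlong_extend x v
  have hc : SmoothNear E (fun _ : M ↦ c) x := SmoothNear.const c
  have h := covAlong_covAlong hσ (hv.smul hc) u
  simp only [FiberBundle.extend_apply_self, (isLinearMap_covAlong φ σ _).map_smul] at h
  rw [covAlong_smul hc.mdifferentiableAt (hσ.covAlong hv).diffAlongAt, mvfderiv_const,
    leviCivita_const_smul hv, (isLinearMap_covAlong φ σ _).map_smul, ← sub_eq_iff_eq_add] at h
  rw [← h, covAlong₂, smul_sub]
  simp

theorem covDmap_add_right (hφ : ContMDiff 𝓘(ℝ, E) 𝓘(ℝ, F) ∞ φ)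
    (u v w : TangentSpace 𝓘(ℝ, E) x) :
    covDmap (F := F) φ x u (v + w) = covDmap φ x u v + covDmap φ x u w := by
  have hv := smoothAlong_extend x v
  have hw := smoothAlong_extend x w
  have h := covAlong_dmap hφ (hv.add hw) u
  simp only [FiberBundle.extend_apply_self, (isLinearMap_dmap (E := E) (F := F) φ _).map_add] at h
  rw [covAlong_add (hv.dmap hφ).diffAlongAt (hw.dmap hφ).diffAlongAt,
    leviCivita_add hv hw, (isLinearMap_dmap (E := E) (F := F) φ _).map_add, ← sub_eq_iff_eq_add] at h
  rw [← h, covDmap, covDmap]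
  abel

theorem covDmap_smul_right (hφ : ContMDiff 𝓘(ℝ, E) 𝓘(ℝ, F) ∞ φ) (c : ℝ)
    (u v : TangentSpace 𝓘(ℝ, E) x) :
    covDmap (F := F) φ x u (c • v) = c • covDmap φ x u v := by
  have hv := smoothAlong_extend x v
  have hc : SmoothNear E (fun _ : M ↦ c) x := SmoothNear.const c
  have h := covAlong_dmap hφ (hv.smul hc) u
  simp only [FiberBundle.extend_apply_self, (isLinearMap_dmap (E := E) (F := F) φ _).map_smul] at h
  rw [covAlong_smul hc.mdifferentiableAt (hv.dmap hφ).diffAlongAt, mvfderiv_const,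
    leviCivita_const_smul hv, (isLinearMap_dmap (E := E) (F := F) φ _).map_smul, ← sub_eq_iff_eq_add] at h
  rw [← h, covDmap, smul_sub]
  simp

end SecondDerivative

/-! ### Coordinate fields commute; the connection is torsion-free -/

section CoordinateFields

variable {F : Type*} [NormedAddCommGroup F] [NormedSpace ℝ F]
  {N : Type*} [TopologicalSpace N] [ChartedSpace F N] [IsManifold 𝓘(ℝ, F) ∞ N]

theorem eventually_mem_chart_source (p : N) : ∀ᶠ q in 𝓝 p, q ∈ (chartAt F p).source :=
  (chartAt F p).open_source.mem_nhds (mem_chart_source F p)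

theorem mpullbackWithin_extend (p : N) (u : TangentSpace 𝓘(ℝ, F) p) {z : F}
    (hz : z ∈ (extChartAt 𝓘(ℝ, F) p).target) :
    VectorField.mpullbackWithin 𝓘(ℝ, F) 𝓘(ℝ, F) (extChartAt 𝓘(ℝ, F) p).symm
      (FiberBundle.extend F u) (Set.range 𝓘(ℝ, F)) z = coord p p u := by
  have hq := extChartAt_symm_mem_source hz
  have hA := isInvertible_mfderivWithin_extChartAt_symm hz
  refine hA.inverse_apply_eq.2 ?_
  rw [← coord_extend hq u, coord_eq_mfderiv hq]
  exact (DFunLike.congr_fun (mfderivWithin_extChartAt_symm_comp_mfderiv_extChartAt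
    (I := 𝓘(ℝ, F)) hz) (FiberBundle.extend F u _)).symm

/-- In the chart at `p` both fields are constant. Hence the bracket term in the definition of
`curvature` drops out. -/
theorem mlieBracket_extend (p : N) (u v : TangentSpace 𝓘(ℝ, F) p) :
    VectorField.mlieBracket 𝓘(ℝ, F) (FiberBundle.extend F u) (FiberBundle.extend F v) p = 0 := by
  rw [← VectorField.mlieBracketWithin_univ, VectorField.mlieBracketWithin_apply]
  have hz := extChartAt_mem_target (mem_chart_source F p)
  have hmem := extChartAt_target_mem (mem_chart_source F p)
  have h : ∀ u : TangentSpace 𝓘(ℝ, F) p,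
      VectorField.mpullbackWithin 𝓘(ℝ, F) 𝓘(ℝ, F) (extChartAt 𝓘(ℝ, F) p).symm
        (FiberBundle.extend F u) (Set.range 𝓘(ℝ, F)) =ᶠ[𝓝 (extChartAt 𝓘(ℝ, F) p p)]
      fun _ ↦ coord p p u := fun u ↦ by
    filter_upwards [hmem] with z hz using mpullbackWithin_extend p u hz
  have h0 : VectorField.lieBracketWithin ℝ (fun _ : F ↦ coord p p u) (fun _ : F ↦ coord p p v)
      ((extChartAt 𝓘(ℝ, F) p).symm ⁻¹' Set.univ ∩ Set.range 𝓘(ℝ, F))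
        (extChartAt 𝓘(ℝ, F) p p) = 0 := by
    simp [VectorField.lieBracketWithin]
  have h1 := Filter.EventuallyEq.lieBracketWithin_vectorField_eq (𝕜 := ℝ)
    (s := (extChartAt 𝓘(ℝ, F) p).symm ⁻¹' Set.univ ∩ Set.range 𝓘(ℝ, F))
    ((h u).filter_mono nhdsWithin_le_nhds) (h u).self_of_nhds
    ((h v).filter_mono nhdsWithin_le_nhds) (h v).self_of_nhds
  rw [h0] at h1
  exact (congrArg _ h1).trans (map_zero _)

theorem contDiffAt_comp_extChartAt_symm {G : Type*} [NormedAddCommGroup G] [NormedSpace ℝ G]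
    {f : N → G} {p q : N} (hf : ContMDiffAt 𝓘(ℝ, F) 𝓘(ℝ, G) ∞ f q)
    (hq : q ∈ (chartAt F p).source) :
    ContDiffAt ℝ ∞ (f ∘ (extChartAt 𝓘(ℝ, F) p).symm) (extChartAt 𝓘(ℝ, F) p q) := by
  rw [← contMDiffAt_iff_contDiffAt]
  have h := (contMDiffOn_extChartAt_symm (I := 𝓘(ℝ, F)) (n := ∞) p).contMDiffAt
    (extChartAt_target_mem hq)
  refine ContMDiffAt.comp _ ?_ h
  rwa [(extChartAt 𝓘(ℝ, F) p).left_inv (by simpa using hq)]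

theorem mvfderiv_extend {G : Type*} [NormedAddCommGroup G] [NormedSpace ℝ G] {f : N → G} {p : N}
    (hf : ∀ᶠ q in 𝓝 p, ContMDiffAt 𝓘(ℝ, F) 𝓘(ℝ, G) ∞ f q) :
    ∀ᶠ q in 𝓝 p, ∀ v : TangentSpace 𝓘(ℝ, F) p,
      mvfderiv 𝓘(ℝ, F) f q (FiberBundle.extend F v q)
        = fderiv ℝ (f ∘ (extChartAt 𝓘(ℝ, F) p).symm) (extChartAt 𝓘(ℝ, F) p q) (coord p p v) := by
  filter_upwards [hf, eventually_eventually_nhds.2 (eventually_mem_chart_source (F := F) p)]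
    with q h1 h2 v
  have hq := h2.self_of_nhds
  have h3 : f =ᶠ[𝓝 q] fun y ↦ (f ∘ (extChartAt 𝓘(ℝ, F) p).symm) (extChartAt 𝓘(ℝ, F) p y) := by
    filter_upwards [h2] with y hy
    rw [Function.comp_apply, (extChartAt 𝓘(ℝ, F) p).left_inv (by simpa using hy)]
  rw [h3.mvfderiv_eq, mvfderiv_comp_fderiv
    ((contDiffAt_comp_extChartAt_symm h1 hq).differentiableAt (by simp)).hasFDerivAt
    (mdifferentiableAt_extChartAt hq), ← coord_extend hq v, coord_eq_mfderiv hq]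
  rfl

/-- Second derivatives along coordinate fields commute. -/
theorem mvfderiv_mvfderiv_comm {G : Type*} [NormedAddCommGroup G] [NormedSpace ℝ G] {f : N → G}
    {p : N} (hf : ∀ᶠ q in 𝓝 p, ContMDiffAt 𝓘(ℝ, F) 𝓘(ℝ, G) ∞ f q)
    (u v : TangentSpace 𝓘(ℝ, F) p) :
    mvfderiv 𝓘(ℝ, F) (fun q ↦ mvfderiv 𝓘(ℝ, F) f q (FiberBundle.extend F v q)) p u
      = mvfderiv 𝓘(ℝ, F) (fun q ↦ mvfderiv 𝓘(ℝ, F) f q (FiberBundle.extend F u q)) p v := by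
  have hp := mem_chart_source F p
  have hg := contDiffAt_comp_extChartAt_symm hf.self_of_nhds hp
  have hg' : DifferentiableAt ℝ (fderiv ℝ (f ∘ (extChartAt 𝓘(ℝ, F) p).symm))
      (extChartAt 𝓘(ℝ, F) p p) := (hg.fderiv_right (m := ∞) (by simp)).differentiableAt (by simp)
  have key : ∀ u v : TangentSpace 𝓘(ℝ, F) p,
      mvfderiv 𝓘(ℝ, F) (fun q ↦ mvfderiv 𝓘(ℝ, F) f q (FiberBundle.extend F v q)) p u
        = fderiv ℝ (fderiv ℝ (f ∘ (extChartAt 𝓘(ℝ, F) p).symm)) (extChartAt 𝓘(ℝ, F) p p)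
          (coord p p u) (coord p p v) := by
    intro u v
    have h1 : (fun q ↦ mvfderiv 𝓘(ℝ, F) f q (FiberBundle.extend F v q)) =ᶠ[𝓝 p] fun q ↦
        fderiv ℝ (f ∘ (extChartAt 𝓘(ℝ, F) p).symm) (extChartAt 𝓘(ℝ, F) p q) (coord p p v) :=
      (mvfderiv_extend hf).mono fun q hq ↦ hq v
    have h2 := hg'.clm_apply (differentiableAt_const (coord p p v))
    rw [h1.mvfderiv_eq, mvfderiv_comp_fderiv (g := fun z ↦
      fderiv ℝ (f ∘ (extChartAt 𝓘(ℝ, F) p).symm) z (coord p p v)) h2.hasFDerivAt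
      (mdifferentiableAt_extChartAt hp), coord_eq_mfderiv hp u]
    exact fderiv_apply_const_apply hg' _ _
  rw [key, key]
  exact (hg.isSymmSndFDerivAt (by
    rw [minSmoothness_of_isRCLikeNormedField]
    exact WithTop.coe_le_coe.2 le_top)).eq _ _

variable [RiemannianBundle (fun p : N ↦ TangentSpace 𝓘(ℝ, F) p)] [FiniteDimensional ℝ F]
  [IsContMDiffRiemannianBundle 𝓘(ℝ, F) ∞ F (fun p : N ↦ TangentSpace 𝓘(ℝ, F) p)]

/-- The connection is torsion-free. -/
theorem leviCivita_extend_comm (p : N) (u v : TangentSpace 𝓘(ℝ, F) p) :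
    ∀ᶠ q in 𝓝 p, leviCivita (FiberBundle.extend F u) q (FiberBundle.extend F v q)
      = leviCivita (FiberBundle.extend F v) q (FiberBundle.extend F u q) := by
  have key : ∀ u v : TangentSpace 𝓘(ℝ, F) p, ∀ᶠ q in 𝓝 p,
      coord p q (leviCivita (FiberBundle.extend F u) q (FiberBundle.extend F v q))
        = christoffel p (extChartAt 𝓘(ℝ, F) p q) (coord p p v) (coord p p u) := by
    intro u v
    filter_upwards [eventually_eventually_nhds.2 (eventually_mem_chart_source (F := F) p),
      (smoothAlong_extend p u).eventually] with q h2 h1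
    have hq := h2.self_of_nhds
    have hc : coordAlong p (fun q : N ↦ q) (FiberBundle.extend F u) =ᶠ[𝓝 q]
        fun _ ↦ coord p p u := by
      filter_upwards [h2] with y hy using coord_extend hy u
    refine (coord_covAlong (φ := fun q : N ↦ q) hq h1.diffAlongAt _).trans ?_
    rw [hc.mvfderiv_eq, mvfderiv_const, hc.self_of_nhds]
    have hid : mfderiv 𝓘(ℝ, F) 𝓘(ℝ, F) (fun q : N ↦ q) q = ContinuousLinearMap.id ℝ _ :=
      mfderiv_id
    rw [hid, ContinuousLinearMap.id_apply, coord_extend hq, _root_.zero_apply, zero_add]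
  filter_upwards [key u v, key v u, eventually_mem_chart_source (F := F) p] with q h1 h2 hq
  refine coord_injective hq ?_
  rw [h1, h2, christoffel_symm]

end CoordinateFields

/-! ### Smoothness of inner products -/

section Inner

variable {E : Type*} [NormedAddCommGroup E] [NormedSpace ℝ E]
  {M : Type*} [TopologicalSpace M] [ChartedSpace E M]
  {F : Type*} [NormedAddCommGroup F] [NormedSpace ℝ F] [FiniteDimensional ℝ F]
  {N : Type*} [TopologicalSpace N] [ChartedSpace F N] [IsManifold 𝓘(ℝ, F) ∞ N]
  [RiemannianBundle (fun p : N ↦ TangentSpace 𝓘(ℝ, F) p)]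
  [IsContMDiffRiemannianBundle 𝓘(ℝ, F) ∞ F (fun p : N ↦ TangentSpace 𝓘(ℝ, F) p)]
  {φ : M → N} {σ ρ : ∀ x, TangentSpace 𝓘(ℝ, F) (φ x)} {x : M}

theorem SmoothAlong.inner (hσ : SmoothAlong E φ σ x) (hρ : SmoothAlong E φ ρ x) :
    SmoothNear E (fun y ↦ (inner ℝ (σ y) (ρ y) : ℝ)) x := by
  filter_upwards [hσ, hρ] with q h1 h2
  have h : ContMDiffAt 𝓘(ℝ, E) 𝓘(ℝ) ∞ (fun q ↦ (Inner.inner ℝ (σ q) (ρ q) : ℝ)) q :=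
    ContMDiffAt.inner_bundle h1 h2
  exact h

end Inner

/-! ### Symmetries of the curvature and second derivatives of Killing fields -/

section Curvature

variable {F : Type*} [NormedAddCommGroup F] [NormedSpace ℝ F] [FiniteDimensional ℝ F]
  {N : Type*} [TopologicalSpace N] [ChartedSpace F N] [IsManifold 𝓘(ℝ, F) ∞ N]
  [RiemannianBundle (fun p : N ↦ TangentSpace 𝓘(ℝ, F) p)]
  [IsContMDiffRiemannianBundle 𝓘(ℝ, F) ∞ F (fun p : N ↦ TangentSpace 𝓘(ℝ, F) p)]
  {X Y V : ∀ p : N, TangentSpace 𝓘(ℝ, F) p} {p : N}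

theorem SmoothAlong.leviCivita (hX : SmoothAlong F (fun q : N ↦ q) X p)
    (hV : SmoothAlong F (fun q : N ↦ q) V p) :
    SmoothAlong F (fun q : N ↦ q) (fun q ↦ leviCivita X q (V q)) p :=
  hX.covAlong hV

theorem leviCivita_congr (h : ∀ᶠ q in 𝓝 p, X q = Y q) (u : TangentSpace 𝓘(ℝ, F) p) :
    leviCivita X p u = leviCivita Y p u :=
  covAlong_congr h u

theorem leviCivita_smul {f : N → ℝ} (hf : SmoothNear F f p)
    (hX : SmoothAlong F (fun q : N ↦ q) X p) (u : TangentSpace 𝓘(ℝ, F) p) :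
    leviCivita (fun q ↦ f q • X q) p u
      = mvfderiv 𝓘(ℝ, F) f p u • X p + f p • leviCivita X p u :=
  covAlong_smul hf.mdifferentiableAt hX.diffAlongAt u

theorem SmoothNear.mvfderiv {f : N → ℝ} (hf : SmoothNear F f p)
    (hV : SmoothAlong F (fun q : N ↦ q) V p) :
    SmoothNear F (fun q ↦ mvfderiv 𝓘(ℝ, F) f q (V q)) p := by
  filter_upwards [hf, hV.eventually] with q h1 h2 using contMDiffAt_mvfderiv h1 h2

/-- The curvature operator applied to coordinate fields and an arbitrary vector field. -/
def curvatureOp (p : N) (u v : TangentSpace 𝓘(ℝ, F) p) (X : ∀ p : N, TangentSpace 𝓘(ℝ, F) p) :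
    TangentSpace 𝓘(ℝ, F) p :=
  leviCivita (fun q ↦ leviCivita X q (FiberBundle.extend F v q)) p u
    - leviCivita (fun q ↦ leviCivita X q (FiberBundle.extend F u q)) p v

theorem curvature_eq_curvatureOp_extend (p : N) (u v w : TangentSpace 𝓘(ℝ, F) p) :
    curvature p u v w = curvatureOp p u v (FiberBundle.extend F w) := by
  rw [curvature, curvatureField, mlieBracket_extend, (isLinearMap_leviCivita _ p).map_zero,
    sub_zero, curvatureOp, FiberBundle.extend_apply_self, FiberBundle.extend_apply_self]

/-- `curvatureOp` is linear over functions: for `f • X` the second derivatives of `f` commute along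
coordinate fields, and the mixed first-order terms are symmetric in `u, v`. So only `X p` matters.
-/
theorem curvatureOp_eq (hX : SmoothAlong F (fun q : N ↦ q) X p)
    (u v : TangentSpace 𝓘(ℝ, F) p) : curvatureOp p u v X = curvature p u v (X p) := by
  rw [curvature_eq_curvatureOp_extend]
  have hU := smoothAlong_extend p u
  have hV := smoothAlong_extend p v
  refine eq_of_tensorial (ψ := fun q : N ↦ q) (x := p) contMDiff_id (curvatureOp p u v) ?_ ?_ ?_
    hX (smoothAlong_extend p (X p)) (FiberBundle.extend_apply_self F (X p)).symm
  · intro τ ρ _ _ h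
    have h' : ∀ v : TangentSpace 𝓘(ℝ, F) p, ∀ᶠ q in 𝓝 p,
        leviCivita τ q (FiberBundle.extend F v q) = leviCivita ρ q (FiberBundle.extend F v q) := by
      intro v
      filter_upwards [eventually_eventually_nhds.2 h] with q hq using leviCivita_congr hq _
    rw [curvatureOp, curvatureOp, leviCivita_congr (h' u), leviCivita_congr (h' v)]
  · intro τ ρ hτ hρ
    have h : ∀ v : TangentSpace 𝓘(ℝ, F) p, ∀ᶠ q in 𝓝 p,
        leviCivita (fun q ↦ τ q + ρ q) q (FiberBundle.extend F v q)
          = leviCivita τ q (FiberBundle.extend F v q)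
            + leviCivita ρ q (FiberBundle.extend F v q) := by
      intro v
      filter_upwards [hτ.eventually, hρ.eventually] with q h1 h2 using leviCivita_add h1 h2 _
    simp only [curvatureOp]
    rw [leviCivita_congr (h u), leviCivita_congr (h v),
      leviCivita_add (hτ.leviCivita hU) (hρ.leviCivita hU),
      leviCivita_add (hτ.leviCivita hV) (hρ.leviCivita hV)]
    abel
  · intro f τ hf hτ
    have h : ∀ v : TangentSpace 𝓘(ℝ, F) p, ∀ᶠ q in 𝓝 p,
        leviCivita (fun q ↦ f q • τ q) q (FiberBundle.extend F v q)
          = mvfderiv 𝓘(ℝ, F) f q (FiberBundle.extend F v q) • τ q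
            + f q • leviCivita τ q (FiberBundle.extend F v q) := by
      intro v
      filter_upwards [eventually_eventually_nhds.2 hf, hτ.eventually] with q h1 h2
        using leviCivita_smul h1 h2 _
    have key : ∀ u v : TangentSpace 𝓘(ℝ, F) p,
        leviCivita (fun q ↦ leviCivita (fun q ↦ f q • τ q) q (FiberBundle.extend F v q)) p u
          = mvfderiv 𝓘(ℝ, F) (fun q ↦ mvfderiv 𝓘(ℝ, F) f q (FiberBundle.extend F v q)) p u • τ p
            + mvfderiv 𝓘(ℝ, F) f p v • leviCivita τ p u
            + (mvfderiv 𝓘(ℝ, F) f p u • leviCivita τ p v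
            + f p • leviCivita (fun q ↦ leviCivita τ q (FiberBundle.extend F v q)) p u) := by
      intro u v
      have hV := smoothAlong_extend p v
      rw [leviCivita_congr (h v), leviCivita_add ((hτ.smul (hf.mvfderiv hV)))
        ((hτ.leviCivita hV).smul hf), leviCivita_smul (hf.mvfderiv hV) hτ,
        leviCivita_smul hf (hτ.leviCivita hV), FiberBundle.extend_apply_self]
    rw [curvatureOp, key, key, mvfderiv_mvfderiv_comm hf u v, curvatureOp, smul_sub]
    abel

/-- The Ricci identity. -/
theorem covAlong₂_sub_comm (hX : SmoothAlong F (fun q : N ↦ q) X p)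
    (u v : TangentSpace 𝓘(ℝ, F) p) :
    covAlong₂ (fun q : N ↦ q) X p u v - covAlong₂ (fun q : N ↦ q) X p v u
      = curvature p u v (X p) := by
  -- Absence of torsion makes the two correction terms of `covAlong₂` equal, so they cancel in the
  -- difference.
  have h := (leviCivita_extend_comm p v u).self_of_nhds
  rw [FiberBundle.extend_apply_self, FiberBundle.extend_apply_self] at h
  rw [← curvatureOp_eq hX, covAlong₂, covAlong₂, h]
  exact sub_sub_sub_cancel_right _ _ _

theorem curvature_swap (p : N) (u v w : TangentSpace 𝓘(ℝ, F) p) :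
    curvature p v u w = -curvature p u v w := by
  rw [curvature_eq_curvatureOp_extend, curvature_eq_curvatureOp_extend, curvatureOp, curvatureOp,
    neg_sub]

/-- The first Bianchi identity. -/
theorem curvature_bianchi (p : N) (u v w : TangentSpace 𝓘(ℝ, F) p) :
    curvature p u v w + curvature p v w u + curvature p w u v = 0 := by
  simp only [curvature_eq_curvatureOp_extend, curvatureOp]
  rw [leviCivita_congr (leviCivita_extend_comm p w v) u,
    leviCivita_congr (leviCivita_extend_comm p w u) v,
    leviCivita_congr (leviCivita_extend_comm p v u) w]
  abel

/-- Second derivatives of the function `⟨W, Z⟩` along coordinate fields commute; expanding both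
orders by metric compatibility, the products of first derivatives cancel and the two curvature terms
remain. -/
theorem inner_curvature_swap (p : N) (u v w z : TangentSpace 𝓘(ℝ, F) p) :
    inner ℝ (curvature p u v w) z = -(inner ℝ (curvature p u v z) w : ℝ) := by
  have hW := smoothAlong_extend p w
  have hZ := smoothAlong_extend p z
  set W := FiberBundle.extend F w with hWdef
  set Z := FiberBundle.extend F z with hZdef
  have key : ∀ u v : TangentSpace 𝓘(ℝ, F) p,
      mvfderiv 𝓘(ℝ, F) (fun q ↦ mvfderiv 𝓘(ℝ, F) (fun q ↦ (inner ℝ (W q) (Z q) : ℝ)) q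
        (FiberBundle.extend F v q)) p u
      = inner ℝ (leviCivita (fun q ↦ leviCivita W q (FiberBundle.extend F v q)) p u) z
        + inner ℝ (leviCivita W p v) (leviCivita Z p u)
        + (inner ℝ (leviCivita W p u) (leviCivita Z p v)
        + inner ℝ w (leviCivita (fun q ↦ leviCivita Z q (FiberBundle.extend F v q)) p u)) := by
    intro u v
    have hV := smoothAlong_extend p v
    have h1 : (fun q ↦ mvfderiv 𝓘(ℝ, F) (fun q ↦ (inner ℝ (W q) (Z q) : ℝ)) q
        (FiberBundle.extend F v q)) =ᶠ[𝓝 p] fun q ↦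
          (inner ℝ (leviCivita W q (FiberBundle.extend F v q)) (Z q) : ℝ)
          + inner ℝ (W q) (leviCivita Z q (FiberBundle.extend F v q)) := by
      filter_upwards [hW.eventually, hZ.eventually] with q h1 h2
      exact mvfderiv_inner (φ := fun q : N ↦ q) h1.diffAlongAt h2.diffAlongAt _
    rw [h1.mvfderiv_eq]
    refine (DFunLike.congr_fun (mvfderiv_add
      ((hW.leviCivita hV).inner hZ).mdifferentiableAt
      (hW.inner (hZ.leviCivita hV)).mdifferentiableAt) u).trans ?_
    rw [_root_.add_apply]
    refine (congrArg₂ (· + ·) (mvfderiv_inner (φ := fun q : N ↦ q)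
      (hW.leviCivita hV).diffAlongAt hZ.diffAlongAt u) (mvfderiv_inner (φ := fun q : N ↦ q)
      hW.diffAlongAt (hZ.leviCivita hV).diffAlongAt u)).trans ?_
    rw [FiberBundle.extend_apply_self, hWdef, hZdef, FiberBundle.extend_apply_self,
      FiberBundle.extend_apply_self]
    rfl
  have h := mvfderiv_mvfderiv_comm (hW.inner hZ) u v
  rw [key, key] at h
  rw [curvature_eq_curvatureOp_extend, curvature_eq_curvatureOp_extend, curvatureOp, curvatureOp,
    inner_sub_left, inner_sub_left]
  have hc : ∀ a : TangentSpace 𝓘(ℝ, F) p, (inner ℝ w a : ℝ) = inner ℝ a w := fun a ↦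
    real_inner_comm a w
  rw [hc, hc] at h
  linarith

/-- The classical argument: the four Bianchi identities on `u, v, w, z` are combined using skewness
in the first and in the last pair. -/
theorem inner_curvature_pair_symm (p : N) (u v w z : TangentSpace 𝓘(ℝ, F) p) :
    (inner ℝ (curvature p u v w) z : ℝ) = inner ℝ (curvature p w z u) v := by
  have hb : ∀ u v w z : TangentSpace 𝓘(ℝ, F) p, (inner ℝ (curvature p u v w) z : ℝ)
      + inner ℝ (curvature p v w u) z + inner ℝ (curvature p w u v) z = 0 := by
    intro u v w z
    rw [← inner_add_left, ← inner_add_left, curvature_bianchi, inner_zero_left]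
  have hs : ∀ u v w z : TangentSpace 𝓘(ℝ, F) p, (inner ℝ (curvature p u v w) z : ℝ)
      = -inner ℝ (curvature p v u w) z := by
    intro u v w z
    rw [curvature_swap p v u, inner_neg_left]
  have ht : ∀ u v w z : TangentSpace 𝓘(ℝ, F) p, (inner ℝ (curvature p u v w) z : ℝ)
      = -inner ℝ (curvature p u v z) w := inner_curvature_swap p
  linarith [hb u v w z, hb v w z u, hb w z u v, hb z u v w, ht u v w z, ht v w u z, ht w u v z,
    ht v w z u, ht w z v u, ht z v w u, ht w z u v, ht z u w v, ht u w z v, ht z u v w,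
    ht u v z w, ht v z u w, hs w u v z, hs u w z v, hs z v w u, hs v z u w, hs w u z v,
    hs z v u w, hs v w u z, hs v w z u, hs z u w v, hs z u v w]

/-- Second derivatives of Killing vector fields are given by the curvature. -/
theorem IsKilling.inner_covAlong₂ (hX : IsKilling X) (p : N) (u w z : TangentSpace 𝓘(ℝ, F) p) :
    (inner ℝ (covAlong₂ (fun q : N ↦ q) X p u w) z : ℝ) = -inner ℝ (curvature p (X p) u w) z := by
  have hXs := hX.1.smoothAlong p
  -- Derivative of the Killing equation in the direction `u`; the terms from differentiating the
  -- extensions vanish by the Killing equation at `p`.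
  have hskew : ∀ u w z : TangentSpace 𝓘(ℝ, F) p,
      (inner ℝ (covAlong₂ (fun q : N ↦ q) X p u w) z : ℝ)
        = -inner ℝ (covAlong₂ (fun q : N ↦ q) X p u z) w := by
    intro u w z
    have hW := smoothAlong_extend p w
    have hZ := smoothAlong_extend p z
    have h0 : (fun q ↦ (inner ℝ (leviCivita X q (FiberBundle.extend F w q))
        (FiberBundle.extend F z q) : ℝ)) + (fun q ↦ (inner ℝ
        (leviCivita X q (FiberBundle.extend F z q)) (FiberBundle.extend F w q) : ℝ))
        = fun _ ↦ (0 : ℝ) := funext fun q ↦ hX.2 q _ _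
    have h1 := mvfderiv_add (I := 𝓘(ℝ, F)) ((hXs.leviCivita hW).inner hZ).mdifferentiableAt
      ((hXs.leviCivita hZ).inner hW).mdifferentiableAt
    rw [h0, mvfderiv_const] at h1
    have h2 := (DFunLike.congr_fun h1 u).trans (congrArg₂ (· + ·)
      (mvfderiv_inner (φ := fun q : N ↦ q) (hXs.leviCivita hW).diffAlongAt hZ.diffAlongAt u)
      (mvfderiv_inner (φ := fun q : N ↦ q) (hXs.leviCivita hZ).diffAlongAt hW.diffAlongAt u))
    have h3 := covAlong_covAlong (φ := fun q : N ↦ q) hXs hW u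
    have h4 := covAlong_covAlong (φ := fun q : N ↦ q) hXs hZ u
    have h5 := hX.2 p w (leviCivita (FiberBundle.extend F z) p u)
    have h6 := hX.2 p z (leviCivita (FiberBundle.extend F w) p u)
    simp only [lieDerivMetric, leviCivita, FiberBundle.extend_apply_self,
      _root_.zero_apply] at h2 h3 h4 h5 h6
    rw [h3, h4, inner_add_left, inner_add_left] at h2
    linarith
  have hric : ∀ u w z : TangentSpace 𝓘(ℝ, F) p,
      (inner ℝ (covAlong₂ (fun q : N ↦ q) X p u w) z : ℝ)
        = inner ℝ (covAlong₂ (fun q : N ↦ q) X p w u) z + inner ℝ (curvature p u w (X p)) z := by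
    intro u w z
    rw [← inner_add_left, ← covAlong₂_sub_comm hXs, add_sub_cancel]
  have hb : (inner ℝ (curvature p (X p) u w) z : ℝ) + inner ℝ (curvature p (X p) w z) u
      + inner ℝ (curvature p (X p) z u) w = 0 := by
    have h : (inner ℝ (curvature p w z u) (X p) : ℝ) + inner ℝ (curvature p z u w) (X p)
        + inner ℝ (curvature p u w z) (X p) = 0 := by
      rw [← inner_add_left, ← inner_add_left, curvature_bianchi, inner_zero_left]
    linarith [inner_curvature_pair_symm p (X p) u w z, inner_curvature_pair_symm p (X p) w z u,
      inner_curvature_pair_symm p (X p) z u w, inner_curvature_swap p w z u (X p),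
      inner_curvature_swap p z u w (X p), inner_curvature_swap p u w z (X p)]
  -- As in Koszul's formula, a trilinear form skew in its last two slots is determined by its
  -- antisymmetrization in the first two, here a curvature by the Ricci identity. Bianchi (`hb`)
  -- reduces the resulting three curvature terms to one.
  linarith [hskew u w z, hskew w u z, hskew w z u, hskew z w u, hskew z u w, hskew u z w,
    hric u w z, hric w z u, hric z u w, inner_curvature_pair_symm p u w (X p) z,
    inner_curvature_pair_symm p w z (X p) u, inner_curvature_pair_symm p z u (X p) w]

end Curvature

/-! ### Metric duals, smooth traces and iterated Laplacians of the tension field -/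

section Trace

variable {E : Type*} [NormedAddCommGroup E] [NormedSpace ℝ E] [FiniteDimensional ℝ E]
  {M : Type*} [TopologicalSpace M] [ChartedSpace E M] [IsManifold 𝓘(ℝ, E) ∞ M]
  [RiemannianBundle (fun x : M ↦ TangentSpace 𝓘(ℝ, E) x)]

theorem inner_sharp {x : M} {η : TangentSpace 𝓘(ℝ, E) x → ℝ} (hη : IsLinearMap ℝ η)
    (v : TangentSpace 𝓘(ℝ, E) x) : inner ℝ (sharp x η) v = η v := by
  have h := map_sum (hη.mk' η) (fun j ↦ (inner ℝ (frame E x j) v : ℝ) • frame E x j) Finset.univ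
  rw [(frame E x).sum_repr' v] at h
  refine Eq.trans ?_ h.symm
  rw [sharp, sum_inner]
  refine Finset.sum_congr rfl fun j _ ↦ ?_
  rw [real_inner_smul_left, map_smul, smul_eq_mul, mul_comm]
  rfl

/-- One-forms on `M` that are smooth near `x`. -/
structure SmoothForm (η : ∀ x : M, TangentSpace 𝓘(ℝ, E) x → ℝ) (x : M) : Prop where
  isLinearMap : ∀ y, IsLinearMap ℝ (η y)
  smooth : ∀ V, SmoothAlong E (fun y : M ↦ y) V x → SmoothNear E (fun y ↦ η y (V y)) x

variable [IsContMDiffRiemannianBundle 𝓘(ℝ, E) ∞ E (fun x : M ↦ TangentSpace 𝓘(ℝ, E) x)]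
  {x : M}

/-- The orthonormal bases in `sharp` need not vary continuously. By `inner_sharp` the dual does not
depend on them, and its components are the inverse metric applied to the components of `η`. -/
theorem SmoothForm.sharp {η : ∀ x : M, TangentSpace 𝓘(ℝ, E) x → ℝ} (hη : SmoothForm η x) :
    SmoothAlong E (fun y : M ↦ y) (fun y ↦ sharp y (η y)) x := by
  classical
  set b := Module.finBasis ℝ E with hb
  let L : Fin (Module.finrank ℝ E) → (E →L[ℝ] ℝ) := fun i ↦
    LinearMap.toContinuousLinearMap (b.coord i)
  let ηc : M → (E →L[ℝ] ℝ) := fun y ↦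
    ∑ i, η y (FiberBundle.extend E (frameVec x i) y) • L i
  have hs : ∀ i, SmoothNear E (fun y ↦ η y (FiberBundle.extend E (frameVec x i) y)) x := fun i ↦
    hη.smooth _ (smoothAlong_extend x (frameVec x i))
  have hηc : ∀ᶠ y in 𝓝 x, ContMDiffAt 𝓘(ℝ, E) 𝓘(ℝ, E →L[ℝ] ℝ) ∞ ηc y := by
    filter_upwards [eventually_all.2 hs] with y hy
    exact ContMDiffAt.sum fun i _ ↦ (hy i).smul contMDiffAt_const
  have hcoord : ∀ y ∈ (chartAt E x).source,
      coordAlong x (fun y : M ↦ y) (fun y ↦ Polyharmonic.sharp y (η y)) y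
        = (metricInChart x (extChartAt 𝓘(ℝ, E) x y)).inverse (ηc y) := by
    intro y hy
    symm
    refine (isInvertible_metricInChart (extChartAt_mem_target hy)).inverse_apply_eq.2 ?_
    ext a
    rw [metricInChart_extChartAt hy, coordAlong, coordSymm_coord hy, inner_sharp (hη.isLinearMap y)]
    have h1 : coordSymm x y a = ∑ i, b.repr a i • FiberBundle.extend E (frameVec x i) y := by
      refine coord_injective hy ?_
      simp only [map_sum, map_smul, coord_extend hy, frameVec,
        coord_coordSymm (mem_chart_source E x), coord_coordSymm hy]
      exact (b.sum_repr a).symm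
    have h2 := map_sum ((hη.isLinearMap y).mk' _)
      (fun i ↦ b.repr a i • FiberBundle.extend E (frameVec x i) y) Finset.univ
    rw [← h1] at h2
    refine Eq.trans ?_ h2.symm
    simp only [ηc, L, _root_.sum_apply, _root_.smul_apply, smul_eq_mul]
    refine Finset.sum_congr rfl fun i _ ↦ ?_
    rw [map_smul, smul_eq_mul, mul_comm]
    rfl
  filter_upwards [hηc, eventually_eventually_nhds.2 (eventually_mem_chart_source (F := E) x)]
    with y h1 h2
  have hy := h2.self_of_nhds
  have hz := extChartAt_mem_target hy
  have hid : ContMDiffAt 𝓘(ℝ, E) 𝓘(ℝ, E) ∞ (fun y : M ↦ y) y := contMDiffAt_id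
  rw [contMDiffAt_along_iff hy hid]
  have hI : ContDiffAt ℝ ∞ (fun z ↦ (metricInChart x z).inverse) (extChartAt 𝓘(ℝ, E) x y) :=
    ContDiffAt.comp (g := ContinuousLinearMap.inverse) _
      (isInvertible_metricInChart hz).contDiffAt_map_inverse (contDiffAt_metricInChart hz)
  have hI' : ContMDiffAt 𝓘(ℝ, E) 𝓘(ℝ, (E →L[ℝ] ℝ) →L[ℝ] E) ∞
      (fun y ↦ (metricInChart x (extChartAt 𝓘(ℝ, E) x y)).inverse) y :=
    ContDiffAt.comp_contMDiffAt (f := fun y ↦ extChartAt 𝓘(ℝ, E) x y) hI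
      (contMDiffAt_extChartAt' hy)
  refine (hI'.clm_apply h1).congr_of_eventuallyEq ?_
  filter_upwards [h2] with y hy using hcoord y hy

variable {F : Type*} [NormedAddCommGroup F] [NormedSpace ℝ F] [FiniteDimensional ℝ F]
  {N : Type*} [TopologicalSpace N] [ChartedSpace F N] [IsManifold 𝓘(ℝ, F) ∞ N]
  [RiemannianBundle (fun p : N ↦ TangentSpace 𝓘(ℝ, F) p)]
  [IsContMDiffRiemannianBundle 𝓘(ℝ, F) ∞ F (fun p : N ↦ TangentSpace 𝓘(ℝ, F) p)]
  {φ : M → N} {σ : ∀ x, TangentSpace 𝓘(ℝ, F) (φ x)}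

/-- The metric trace of a smooth bilinear form with values in `φ^* TN` is smooth. -/
theorem SmoothAlong.trace (hφ : ContMDiff 𝓘(ℝ, E) 𝓘(ℝ, F) ∞ φ)
    {B : ∀ x : M, TangentSpace 𝓘(ℝ, E) x → TangentSpace 𝓘(ℝ, E) x → TangentSpace 𝓘(ℝ, F) (φ x)}
    (hl : ∀ y v, IsLinearMap ℝ fun u ↦ B y u v) (hr : ∀ y u, IsLinearMap ℝ (B y u))
    (hB : ∀ U V, SmoothAlong E (fun y : M ↦ y) U x → SmoothAlong E (fun y : M ↦ y) V x →
      SmoothAlong E φ (fun y ↦ B y (U y) (V y)) x) :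
    SmoothAlong E φ (fun y ↦ ∑ j, B y (frame E y j) (frame E y j)) x := by
  -- With `η i` the coframe dual to the coordinate frame `E_i`, the trace is `∑ i, B(E_i, (η i)^♯)`,
  -- in which only smooth fields occur.
  let η : Fin (Module.finrank ℝ E) → ∀ y : M, TangentSpace 𝓘(ℝ, E) y → ℝ := fun i y v ↦
    (Module.finBasis ℝ E).coord i (coord x y v)
  have hη : ∀ i, SmoothForm (η i) x := fun i ↦
    ⟨fun y ↦ ⟨fun v w ↦ by simp only [η, map_add], fun c v ↦ by simp only [η, map_smul]⟩,
      fun V hV ↦ smoothNear_frameCoeff hV i⟩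
  refine (SmoothAlong.sum hφ Finset.univ fun i ↦
    hB _ _ (smoothAlong_extend x (frameVec x i)) (hη i).sharp).congr ?_
  filter_upwards [eventually_mem_chart_source (F := E) x] with y hy
  have hv : ∀ v : TangentSpace 𝓘(ℝ, E) y,
      v = ∑ i, η i y v • FiberBundle.extend E (frameVec x i) y := by
    intro v
    refine coord_injective hy ?_
    simp only [map_sum, map_smul, coord_extend hy, frameVec,
      coord_coordSymm (mem_chart_source E x), η, Module.Basis.coord_apply]
    exact ((Module.finBasis ℝ E).sum_repr _).symm
  have h1 : ∀ j, B y (frame E y j) (frame E y j)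
      = ∑ i, η i y (frame E y j) • B y (FiberBundle.extend E (frameVec x i) y) (frame E y j) := by
    intro j
    have h2 := map_sum ((hl y (frame E y j)).mk' _)
      (fun i ↦ η i y (frame E y j) • FiberBundle.extend E (frameVec x i) y) Finset.univ
    rw [← hv] at h2
    refine h2.trans (Finset.sum_congr rfl fun i _ ↦ ?_)
    exact (hl y (frame E y j)).map_smul _ _
  rw [Finset.sum_congr rfl fun j _ ↦ h1 j, Finset.sum_comm]
  refine Finset.sum_congr rfl fun i _ ↦ ?_
  have h3 := map_sum ((hr y (FiberBundle.extend E (frameVec x i) y)).mk' _)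
    (fun j ↦ η i y (frame E y j) • frame E y j) Finset.univ
  refine Eq.trans ?_ h3.symm
  refine Finset.sum_congr rfl fun j _ ↦ ?_
  exact ((hr y (FiberBundle.extend E (frameVec x i) y)).map_smul _ _).symm

theorem isLinearMap_covDmap_left (φ : M → N) (x : M) (v : TangentSpace 𝓘(ℝ, E) x) :
    IsLinearMap ℝ fun u ↦ covDmap (F := F) φ x u v :=
  ⟨fun u w ↦ by
    simp only [covDmap, (isLinearMap_covAlong φ _ x).map_add, (isLinearMap_leviCivita _ x).map_add,
      (isLinearMap_dmap (F := F) φ x).map_add]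
    abel, fun c u ↦ by
    simp only [covDmap, (isLinearMap_covAlong φ _ x).map_smul,
      (isLinearMap_leviCivita _ x).map_smul, (isLinearMap_dmap (F := F) φ x).map_smul, smul_sub]⟩

theorem isLinearMap_covAlong₂_left (φ : M → N) (σ : ∀ x, TangentSpace 𝓘(ℝ, F) (φ x)) (x : M)
    (v : TangentSpace 𝓘(ℝ, E) x) : IsLinearMap ℝ fun u ↦ covAlong₂ φ σ x u v :=
  ⟨fun u w ↦ by
    simp only [covAlong₂, (isLinearMap_covAlong φ _ x).map_add,
      (isLinearMap_leviCivita _ x).map_add]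
    abel, fun c u ↦ by
    simp only [covAlong₂, (isLinearMap_covAlong φ _ x).map_smul,
      (isLinearMap_leviCivita _ x).map_smul, smul_sub]⟩

theorem smoothAlong_tension (hφ : ContMDiff 𝓘(ℝ, E) 𝓘(ℝ, F) ∞ φ) (x : M) :
    SmoothAlong E φ (tension E F φ) x := by
  refine SmoothAlong.trace hφ (isLinearMap_covDmap_left φ)
    (fun y u ↦ ⟨covDmap_add_right hφ u, fun c ↦ covDmap_smul_right hφ c u⟩) fun U V hU hV ↦ ?_
  refine ((SmoothAlong.dmap hφ hV).covAlong hU |>.sub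
    (SmoothAlong.dmap hφ (hV.covAlong hU))).congr ?_
  filter_upwards [hV.eventually] with y hy
  exact eq_sub_of_add_eq (covAlong_dmap hφ hy (U y)).symm

theorem SmoothAlong.roughLaplacian (hφ : ContMDiff 𝓘(ℝ, E) 𝓘(ℝ, F) ∞ φ)
    (hσ : ∀ x, SmoothAlong E φ σ x) (x : M) : SmoothAlong E φ (roughLaplacian E φ σ) x := by
  refine SmoothAlong.neg (SmoothAlong.trace hφ (isLinearMap_covAlong₂_left φ σ)
    (fun y u ↦ ⟨covAlong₂_add_right (hσ y) u, fun c ↦ covAlong₂_smul_right (hσ y) c u⟩)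
    fun U V hU hV ↦ ?_)
  refine (((hσ x).covAlong hV).covAlong hU |>.sub ((hσ x).covAlong (hV.covAlong hU))).congr ?_
  filter_upwards [hV.eventually] with y hy
  exact eq_sub_of_add_eq (covAlong_covAlong (hσ y) hy (U y)).symm

theorem lapTension_succ (φ : M → N) (k : ℕ) :
    lapTension E F φ (k + 1) = roughLaplacian E φ (lapTension E F φ k) :=
  Function.iterate_succ_apply' _ _ _

theorem smoothAlong_lapTension (hφ : ContMDiff 𝓘(ℝ, E) 𝓘(ℝ, F) ∞ φ) (k : ℕ) (x : M) :
    SmoothAlong E φ (lapTension E F φ k) x := by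
  induction k generalizing x with
  | zero => exact smoothAlong_tension hφ x
  | succ k ih =>
    rw [lapTension_succ]
    exact SmoothAlong.roughLaplacian hφ ih x

end Trace

/-! ### Divergence of one-forms -/

section Divergence

variable {E : Type*} [NormedAddCommGroup E] [NormedSpace ℝ E] [FiniteDimensional ℝ E]
  {M : Type*} [TopologicalSpace M] [ChartedSpace E M] [IsManifold 𝓘(ℝ, E) ∞ M]
  [RiemannianBundle (fun x : M ↦ TangentSpace 𝓘(ℝ, E) x)]
  {x : M} {η θ : ∀ x : M, TangentSpace 𝓘(ℝ, E) x → ℝ} {d d' : ℝ}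

/-- The divergence `∑_j (∇_{e_j} η)(e_j)` of a one-form. -/
def divForm (η : ∀ x : M, TangentSpace 𝓘(ℝ, E) x → ℝ) (x : M) : ℝ :=
  ∑ j, (mvfderiv 𝓘(ℝ, E) (fun y ↦ η y (FiberBundle.extend E (frame E x j) y)) x (frame E x j)
    - η x (leviCivita (FiberBundle.extend E (frame E x j)) x (frame E x j)))

/-- The one-form `η` is smooth near `x` and its divergence at `x` is `d`. -/
structure HasDivergenceAt (η : ∀ x : M, TangentSpace 𝓘(ℝ, E) x → ℝ) (x : M) (d : ℝ) : Prop where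
  smoothForm : SmoothForm η x
  divForm_eq : divForm η x = d

theorem HasDivergenceAt.add (h : HasDivergenceAt η x d) (h' : HasDivergenceAt θ x d') :
    HasDivergenceAt (fun y v ↦ η y v + θ y v) x (d + d') := by
  refine ⟨⟨fun y ↦ ?_, fun V hV ↦ ?_⟩, ?_⟩
  · exact ((h.smoothForm.isLinearMap y).mk' _ + (h'.smoothForm.isLinearMap y).mk' _).isLinear
  · filter_upwards [h.smoothForm.smooth V hV, h'.smoothForm.smooth V hV] with y h1 h2
      using h1.add h2
  · rw [← h.divForm_eq, ← h'.divForm_eq, divForm, divForm, divForm, ← Finset.sum_add_distrib]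
    refine Finset.sum_congr rfl fun j _ ↦ ?_
    have hV := smoothAlong_extend x (frame E x j)
    have := DFunLike.congr_fun (mvfderiv_add (h.smoothForm.smooth _ hV).mdifferentiableAt
      (h'.smoothForm.smooth _ hV).mdifferentiableAt) (frame E x j)
    rw [_root_.add_apply] at this
    refine (congrArg (· - _) this).trans ?_
    ring

theorem HasDivergenceAt.neg (h : HasDivergenceAt η x d) :
    HasDivergenceAt (fun y v ↦ -η y v) x (-d) := by
  refine ⟨⟨fun y ↦ ?_, fun V hV ↦ ?_⟩, ?_⟩
  · exact (-(h.smoothForm.isLinearMap y).mk' _).isLinear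
  · filter_upwards [h.smoothForm.smooth V hV] with y h1 using h1.neg
  · rw [← h.divForm_eq, divForm, divForm, ← Finset.sum_neg_distrib]
    refine Finset.sum_congr rfl fun j _ ↦ ?_
    have hV := smoothAlong_extend x (frame E x j)
    have := DFunLike.congr_fun (mvfderiv_neg (I := 𝓘(ℝ, E))
      (g := fun y ↦ η y (FiberBundle.extend E (frame E x j) y)) (x := x)) (frame E x j)
    rw [_root_.neg_apply] at this
    refine (congrArg (· - _) this).trans ?_
    ring

theorem HasDivergenceAt.sub (h : HasDivergenceAt η x d) (h' : HasDivergenceAt θ x d') :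
    HasDivergenceAt (fun y v ↦ η y v - θ y v) x (d - d') := by
  simpa only [sub_eq_add_neg] using h.add h'.neg

theorem HasDivergenceAt.zero :
    HasDivergenceAt (fun (y : M) (_ : TangentSpace 𝓘(ℝ, E) y) ↦ (0 : ℝ)) x 0 := by
  refine ⟨⟨fun y ↦ ?_, fun V hV ↦ SmoothNear.const 0⟩, ?_⟩
  · exact (0 : TangentSpace 𝓘(ℝ, E) y →ₗ[ℝ] ℝ).isLinear
  · simp [divForm, mvfderiv_const]

theorem HasDivergenceAt.sum {ι : Type*} (s : Finset ι)
    {ζ : ι → ∀ x : M, TangentSpace 𝓘(ℝ, E) x → ℝ} {d : ι → ℝ}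
    (h : ∀ i ∈ s, HasDivergenceAt (ζ i) x (d i)) :
    HasDivergenceAt (fun y v ↦ ∑ i ∈ s, ζ i y v) x (∑ i ∈ s, d i) := by
  classical
  induction s using Finset.induction_on with
  | empty => simpa using HasDivergenceAt.zero
  | insert i s hi ih =>
    simp only [Finset.sum_insert hi]
    exact (h i (Finset.mem_insert_self i s)).add
      (ih fun j hj ↦ h j (Finset.mem_insert_of_mem hj))

variable [IsContMDiffRiemannianBundle 𝓘(ℝ, E) ∞ E (fun x : M ↦ TangentSpace 𝓘(ℝ, E) x)]

/-- Metric compatibility: `⟨∇_e η^♯, e⟩ = e(η(V)) - η(∇_e V)` for an extension `V` of `e`. -/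
theorem HasDivergenceAt.divergence_sharp (h : HasDivergenceAt η x d) :
    divergence (fun y ↦ sharp y (η y)) x = d := by
  rw [← h.divForm_eq, divergence, divForm]
  refine Finset.sum_congr rfl fun j _ ↦ ?_
  have hS := h.smoothForm.sharp
  have hV := smoothAlong_extend x (frame E x j)
  have h1 := mvfderiv_inner (φ := fun y : M ↦ y) hS.diffAlongAt hV.diffAlongAt (frame E x j)
  have h2 : (fun y ↦ (inner ℝ (sharp y (η y)) (FiberBundle.extend E (frame E x j) y) : ℝ))
      = fun y ↦ η y (FiberBundle.extend E (frame E x j) y) :=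
    funext fun y ↦ inner_sharp (h.smoothForm.isLinearMap y) _
  rw [h2, inner_sharp (h.smoothForm.isLinearMap x), FiberBundle.extend_apply_self] at h1
  rw [h1]
  exact (add_sub_cancel_right _ _).symm

variable {F : Type*} [NormedAddCommGroup F] [NormedSpace ℝ F] [FiniteDimensional ℝ F]
  {N : Type*} [TopologicalSpace N] [ChartedSpace F N] [IsManifold 𝓘(ℝ, F) ∞ N]
  [RiemannianBundle (fun p : N ↦ TangentSpace 𝓘(ℝ, F) p)]
  [IsContMDiffRiemannianBundle 𝓘(ℝ, F) ∞ F (fun p : N ↦ TangentSpace 𝓘(ℝ, F) p)]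
  {φ : M → N} {A B : ∀ x, TangentSpace 𝓘(ℝ, F) (φ x)} {X : ∀ p : N, TangentSpace 𝓘(ℝ, F) p}

theorem hasDivergenceAt_inner_covAlong (hA : SmoothAlong E φ A x) (hB : SmoothAlong E φ B x) :
    HasDivergenceAt (fun (y : M) (v : TangentSpace 𝓘(ℝ, E) y) ↦ (inner ℝ (covAlong φ A y v) (B y) : ℝ)) x
      (-inner ℝ (roughLaplacian E φ A x) (B x)
        + ∑ j, inner ℝ (covAlong φ A x (frame E x j)) (covAlong φ B x (frame E x j))) := by
  refine ⟨⟨fun y ↦ ⟨fun v w ↦ ?_, fun c v ↦ ?_⟩, fun V hV ↦ (hA.covAlong hV).inner hB⟩, ?_⟩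
  · rw [(isLinearMap_covAlong φ A y).map_add, inner_add_left]
  · rw [(isLinearMap_covAlong φ A y).map_smul, real_inner_smul_left, smul_eq_mul]
  rw [roughLaplacian, inner_neg_left, neg_neg, sum_inner, ← Finset.sum_add_distrib, divForm]
  refine Finset.sum_congr rfl fun j _ ↦ ?_
  have hV := smoothAlong_extend x (frame E x j)
  rw [mvfderiv_inner (hA.covAlong hV).diffAlongAt hB.diffAlongAt, FiberBundle.extend_apply_self,
    covAlong₂, inner_sub_left]
  ring

/-- Leibniz rule: the derivative falls on `∇X`, on `∇̄A` (whose trace is `-Δ̄A`), or on `B`. -/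
theorem hasDivergenceAt_killingTerm (hφ : ContMDiff 𝓘(ℝ, E) 𝓘(ℝ, F) ∞ φ) (hX : IsKilling X)
    (hA : SmoothAlong E φ A x) (hB : SmoothAlong E φ B x) :
    HasDivergenceAt (E := E) (killingTerm φ X A B) x
      (∑ j, inner ℝ (covAlong₂ (fun q : N ↦ q) X (φ x) (dmap (F := F) φ x (frame E x j))
          (covAlong φ A x (frame E x j))) (B x)
        - inner ℝ (leviCivita X (φ x) (roughLaplacian E φ A x)) (B x)
        + ∑ j, inner ℝ (leviCivita X (φ x) (covAlong φ A x (frame E x j)))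
          (covAlong φ B x (frame E x j))) := by
  have hXs := hX.1.smoothAlong (φ x)
  have hK : ∀ V, SmoothAlong E (fun y : M ↦ y) V x → SmoothAlong E φ
      (fun y ↦ leviCivita X (φ y) (covAlong φ A y (V y))) x := fun V hV ↦
    SmoothAlong.leviCivita_comp hφ hXs (hA.covAlong hV)
  refine ⟨⟨fun y ↦ ⟨fun v w ↦ ?_, fun c v ↦ ?_⟩, fun V hV ↦ (hK V hV).inner hB⟩, ?_⟩
  · rw [killingTerm, (isLinearMap_covAlong φ A y).map_add,
      (isLinearMap_leviCivita X (φ y)).map_add, inner_add_left]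
    rfl
  · rw [killingTerm, (isLinearMap_covAlong φ A y).map_smul,
      (isLinearMap_leviCivita X (φ y)).map_smul, real_inner_smul_left, smul_eq_mul]
    rfl
  have h := map_sum ((isLinearMap_leviCivita X (φ x)).mk' _)
    (fun j ↦ covAlong₂ φ A x (frame E x j) (frame E x j)) Finset.univ
  simp only [IsLinearMap.mk'_apply] at h
  rw [roughLaplacian, (isLinearMap_leviCivita X (φ x)).map_neg, h, inner_neg_left, sub_neg_eq_add,
    sum_inner, ← Finset.sum_add_distrib, ← Finset.sum_add_distrib, divForm]
  refine Finset.sum_congr rfl fun j _ ↦ ?_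
  have hV := smoothAlong_extend x (frame E x j)
  refine (congrArg (· - _) (mvfderiv_inner (hK _ hV).diffAlongAt hB.diffAlongAt _)).trans ?_
  rw [covAlong_leviCivita hφ hXs (hA.covAlong hV), covAlong_covAlong hA hV,
    FiberBundle.extend_apply_self, (isLinearMap_leviCivita X (φ x)).map_add, inner_add_left,
    inner_add_left, killingTerm]
  ring

end Divergence

/-! ### The divergence of the current -/

section Current

variable {E : Type*} [NormedAddCommGroup E] [NormedSpace ℝ E] [FiniteDimensional ℝ E]
  {M : Type*} [TopologicalSpace M] [ChartedSpace E M] [IsManifold 𝓘(ℝ, E) ∞ M]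
  [RiemannianBundle (fun x : M ↦ TangentSpace 𝓘(ℝ, E) x)]
  [IsContMDiffRiemannianBundle 𝓘(ℝ, E) ∞ E (fun x : M ↦ TangentSpace 𝓘(ℝ, E) x)]
  {F : Type*} [NormedAddCommGroup F] [NormedSpace ℝ F] [FiniteDimensional ℝ F]
  {N : Type*} [TopologicalSpace N] [ChartedSpace F N] [IsManifold 𝓘(ℝ, F) ∞ N]
  [RiemannianBundle (fun p : N ↦ TangentSpace 𝓘(ℝ, F) p)]
  [IsContMDiffRiemannianBundle 𝓘(ℝ, F) ∞ F (fun p : N ↦ TangentSpace 𝓘(ℝ, F) p)]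
  {x : M} {φ : M → N} {A B : ∀ x, TangentSpace 𝓘(ℝ, F) (φ x)}
  {X : ∀ p : N, TangentSpace 𝓘(ℝ, F) p}

theorem IsKilling.inner_leviCivita_swap (hX : IsKilling X) (p : N)
    (u v : TangentSpace 𝓘(ℝ, F) p) :
    (inner ℝ (leviCivita X p u) v : ℝ) = -inner ℝ (leviCivita X p v) u :=
  eq_neg_of_add_eq_zero_left (hX.2 p u v)

/-- The curvature symmetries move `X` to the last slot, where the terms of `⟨τ_{2s+1}, X⟩` have it.
-/
theorem IsKilling.inner_covAlong₂_eq_inner (hX : IsKilling X) (p : N)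
    (u w z : TangentSpace 𝓘(ℝ, F) p) :
    (inner ℝ (covAlong₂ (fun q : N ↦ q) X p u w) z : ℝ) = inner ℝ (curvature p w z u) (X p) := by
  rw [hX.inner_covAlong₂, inner_curvature_pair_symm, inner_curvature_swap, neg_neg]

/-- Symmetrizing in `A, B` cancels the sums over `∇̄A` and `∇̄B`, by skewness of `∇X`. What remains
besides curvature is a difference suited to telescoping. -/
theorem hasDivergenceAt_killingTerm_add_swap (hφ : ContMDiff 𝓘(ℝ, E) 𝓘(ℝ, F) ∞ φ)
    (hX : IsKilling X) (hA : SmoothAlong E φ A x) (hB : SmoothAlong E φ B x) :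
    HasDivergenceAt (E := E) (fun y v ↦ killingTerm φ X A B y v + killingTerm φ X B A y v) x
      (inner ℝ (curvTrace E φ A B x - curvTrace' E φ A B x) (X (φ x))
        - inner ℝ (leviCivita X (φ x) (roughLaplacian E φ A x)) (B x)
        + inner ℝ (leviCivita X (φ x) (A x)) (roughLaplacian E φ B x)) := by
  convert (hasDivergenceAt_killingTerm hφ hX hA hB).add
    (hasDivergenceAt_killingTerm hφ hX hB hA) using 1
  have h1 : (inner ℝ (curvTrace E φ A B x) (X (φ x)) : ℝ)
      = ∑ j, inner ℝ (covAlong₂ (fun q : N ↦ q) X (φ x) (dmap (F := F) φ x (frame E x j))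
          (covAlong φ A x (frame E x j))) (B x) := by
    rw [curvTrace, sum_inner]
    refine Finset.sum_congr rfl fun j _ ↦ ?_
    rw [hX.inner_covAlong₂_eq_inner]
  have h2 : (inner ℝ (curvTrace' E φ A B x) (X (φ x)) : ℝ)
      = -∑ j, inner ℝ (covAlong₂ (fun q : N ↦ q) X (φ x) (dmap (F := F) φ x (frame E x j))
          (covAlong φ B x (frame E x j))) (A x) := by
    rw [curvTrace', sum_inner, ← Finset.sum_neg_distrib]
    refine Finset.sum_congr rfl fun j _ ↦ ?_
    rw [hX.inner_covAlong₂_eq_inner, curvature_swap, inner_neg_left]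
  have h3 : ∑ j, (inner ℝ (leviCivita X (φ x) (covAlong φ A x (frame E x j)))
        (covAlong φ B x (frame E x j)) : ℝ)
      = -∑ j, inner ℝ (leviCivita X (φ x) (covAlong φ B x (frame E x j)))
        (covAlong φ A x (frame E x j)) := by
    rw [← Finset.sum_neg_distrib]
    exact Finset.sum_congr rfl fun j _ ↦ hX.inner_leviCivita_swap _ _ _
  rw [inner_sub_left, h1, h2, h3, hX.inner_leviCivita_swap _ (A x)]
  ring

theorem hasDivergenceAt_killingTerm_self (hφ : ContMDiff 𝓘(ℝ, E) 𝓘(ℝ, F) ∞ φ)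
    (hX : IsKilling X) (hA : SmoothAlong E φ A x) :
    HasDivergenceAt (E := E) (killingTerm φ X A A) x
      (inner ℝ (curvTrace E φ A A x) (X (φ x))
        - inner ℝ (leviCivita X (φ x) (roughLaplacian E φ A x)) (A x)) := by
  convert hasDivergenceAt_killingTerm hφ hX hA hA using 1
  have h0 : ∀ u : TangentSpace 𝓘(ℝ, F) (φ x), (inner ℝ (leviCivita X (φ x) u) u : ℝ) = 0 :=
    fun u ↦ self_eq_neg.1 (hX.inner_leviCivita_swap _ u u)
  simp only [h0, Finset.sum_const_zero, add_zero]
  congr 1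
  rw [curvTrace, sum_inner]
  refine Finset.sum_congr rfl fun j _ ↦ ?_
  rw [hX.inner_covAlong₂_eq_inner]

/-- The rough Laplacian of a Killing field along `φ`. -/
theorem inner_roughLaplacian_killing (hφ : ContMDiff 𝓘(ℝ, E) 𝓘(ℝ, F) ∞ φ) (hX : IsKilling X)
    (w : TangentSpace 𝓘(ℝ, F) (φ x)) :
    (inner ℝ (roughLaplacian E φ (fun y ↦ X (φ y)) x) w : ℝ)
      = inner ℝ (∑ j, curvature (φ x) w (dmap (F := F) φ x (frame E x j))
          (dmap (F := F) φ x (frame E x j))) (X (φ x))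
        - inner ℝ (leviCivita X (φ x) (tension E F φ x)) w := by
  have h := map_sum ((isLinearMap_leviCivita X (φ x)).mk' _)
    (fun j ↦ covDmap (F := F) φ x (frame E x j) (frame E x j)) Finset.univ
  simp only [IsLinearMap.mk'_apply] at h
  rw [roughLaplacian, tension, h, inner_neg_left, sum_inner, sum_inner, sum_inner,
    ← Finset.sum_neg_distrib, ← Finset.sum_sub_distrib]
  refine Finset.sum_congr rfl fun j _ ↦ ?_
  rw [covAlong₂_comp hφ (hX.1.smoothAlong _), inner_add_left,
    hX.inner_covAlong₂_eq_inner, curvature_swap, inner_neg_left]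
  ring

/-- Green's identity for `A` and `X ∘ φ`, with the Laplacian of `X ∘ φ` replaced by curvature and
`∇_τ X`. -/
theorem hasDivergenceAt_jacobiTerm (hφ : ContMDiff 𝓘(ℝ, E) 𝓘(ℝ, F) ∞ φ) (hX : IsKilling X)
    (hA : SmoothAlong E φ A x) :
    HasDivergenceAt (fun (y : M) (v : TangentSpace 𝓘(ℝ, E) y) ↦
        (inner ℝ (covAlong φ A y v) (X (φ y))
          - inner ℝ (covAlong φ (fun y ↦ X (φ y)) y v) (A y) : ℝ)) x
      (-inner ℝ (roughLaplacian E φ A x) (X (φ x))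
        + inner ℝ (∑ j, curvature (φ x) (A x) (dmap (F := F) φ x (frame E x j))
            (dmap (F := F) φ x (frame E x j))) (X (φ x))
        - inner ℝ (leviCivita X (φ x) (tension E F φ x)) (A x)) := by
  have hXφ : SmoothAlong E φ (fun y ↦ X (φ y)) x := (hX.1.smoothAlong (φ x)).comp hφ
  convert (hasDivergenceAt_inner_covAlong hA hXφ).sub (hasDivergenceAt_inner_covAlong hXφ hA)
    using 1
  rw [inner_roughLaplacian_killing hφ hX]
  have h : ∑ j, (inner ℝ (covAlong φ A x (frame E x j))
        (covAlong φ (fun y ↦ X (φ y)) x (frame E x j)) : ℝ)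
      = ∑ j, inner ℝ (covAlong φ (fun y ↦ X (φ y)) x (frame E x j))
        (covAlong φ A x (frame E x j)) :=
    Finset.sum_congr rfl fun j _ ↦ real_inner_comm _ _
  rw [h]
  ring

/-- The one-form dual to `currentOdd`. -/
def currentForm (φ : M → N) (X : ∀ p : N, TangentSpace 𝓘(ℝ, F) p) (s : ℕ) (x : M)
    (v : TangentSpace 𝓘(ℝ, E) x) : ℝ :=
  inner ℝ (covAlong φ (lapTension E F φ (2 * s - 1)) x v) (X (φ x))
    - inner ℝ (covAlong φ (fun y ↦ X (φ y)) x v) (lapTension E F φ (2 * s - 1) x)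
    + killingTerm φ X (lapTension E F φ (s - 1)) (lapTension E F φ (s - 1)) x v
    + ∑ l ∈ Finset.Icc 1 (s - 1),
        (killingTerm φ X (lapTension E F φ (s + l - 1)) (lapTension E F φ (s - l - 1)) x v
          + killingTerm φ X (lapTension E F φ (s - l - 1)) (lapTension E F φ (s + l - 1)) x v)

theorem hasDivergenceAt_currentForm (hφ : ContMDiff 𝓘(ℝ, E) 𝓘(ℝ, F) ∞ φ) (hX : IsKilling X)
    {s : ℕ} (hs : 1 ≤ s) (x : M) :
    HasDivergenceAt (currentForm (E := E) φ X s) x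
      (-inner ℝ (tensionOdd E F φ s x) (X (φ x))) := by
  have hD := fun k ↦ smoothAlong_lapTension (F := F) hφ k x
  have h := ((hasDivergenceAt_jacobiTerm hφ hX (hD (2 * s - 1))).add
    (hasDivergenceAt_killingTerm_self hφ hX (hD (s - 1)))).add
    (HasDivergenceAt.sum (Finset.Icc 1 (s - 1)) fun l _ ↦
      hasDivergenceAt_killingTerm_add_swap hφ hX (hD (s + l - 1)) (hD (s - l - 1)))
  have hsucc : ∀ k m, m = k + 1 → roughLaplacian E φ (lapTension E F φ k) = lapTension E F φ m :=
    fun k m hm ↦ by rw [hm, lapTension_succ]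
  -- The telescoping quantity. For `1 ≤ l ≤ s - 1` no subtraction is truncated; for `s = 1` the sum
  -- is empty and `a 0 = a (s - 1)`.
  let a : ℕ → ℝ := fun l ↦ inner ℝ (leviCivita X (φ x) (lapTension E F φ (s + l) x))
    (lapTension E F φ (s - l - 1) x)
  have hterm : ∀ l ∈ Finset.Icc 1 (s - 1),
      (inner ℝ (curvTrace E φ (lapTension E F φ (s + l - 1)) (lapTension E F φ (s - l - 1)) x
            - curvTrace' E φ (lapTension E F φ (s + l - 1)) (lapTension E F φ (s - l - 1)) x)
          (X (φ x))
        - inner ℝ (leviCivita X (φ x) (roughLaplacian E φ (lapTension E F φ (s + l - 1)) x))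
          (lapTension E F φ (s - l - 1) x)
        + inner ℝ (leviCivita X (φ x) (lapTension E F φ (s + l - 1) x))
          (roughLaplacian E φ (lapTension E F φ (s - l - 1)) x) : ℝ)
      = inner ℝ (curvTrace E φ (lapTension E F φ (s + l - 1)) (lapTension E F φ (s - l - 1)) x
            - curvTrace' E φ (lapTension E F φ (s + l - 1)) (lapTension E F φ (s - l - 1)) x)
          (X (φ x)) + (a (l - 1) - a l) := by
    intro l hl
    obtain ⟨h1, h2⟩ := Finset.mem_Icc.1 hl
    rw [hsucc (s + l - 1) (s + l) (by omega), hsucc (s - l - 1) (s - l) (by omega)]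
    simp only [a]
    rw [show s + (l - 1) = s + l - 1 by omega, show s - (l - 1) - 1 = s - l by omega]
    ring
  have htel : ∀ n, ∑ l ∈ Finset.Icc 1 n, (a (l - 1) - a l) = a 0 - a n := by
    intro n
    induction n with
    | zero => simp
    | succ n ih =>
      rw [Finset.sum_Icc_succ_top (by omega), ih, Nat.add_sub_cancel]
      ring
  rw [Finset.sum_congr rfl hterm, Finset.sum_add_distrib, htel, ← sum_inner,
    hsucc (2 * s - 1) (2 * s) (by omega), hsucc (s - 1) s (by omega)] at h
  have h0 : a 0 = inner ℝ (leviCivita X (φ x) (lapTension E F φ s x))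
    (lapTension E F φ (s - 1) x) := rfl
  -- The end of the telescope pairs `Δ̄^{2s-1} τ` with `τ` itself; after a skew swap it cancels the
  -- remainder of `hasDivergenceAt_jacobiTerm`.
  have hlast : a (s - 1) = -inner ℝ (leviCivita X (φ x) (tension E F φ x))
      (lapTension E F φ (2 * s - 1) x) := by
    simp only [a]
    rw [show s + (s - 1) = 2 * s - 1 by omega, show s - (s - 1) - 1 = 0 by omega,
      hX.inner_leviCivita_swap]
    rfl
  convert h using 1
  · rfl
  rw [h0, hlast, tensionOdd, inner_sub_left, inner_sub_left, inner_sub_left]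
  ring

end Current

end Polyharmonic

end

theorem mainTheorem2
    {E : Type*} [NormedAddCommGroup E] [NormedSpace ℝ E] [FiniteDimensional ℝ E]
    {M : Type*} [TopologicalSpace M] [T2Space M] [ChartedSpace E M] [IsManifold 𝓘(ℝ, E) ∞ M]
    [RiemannianBundle (fun x : M ↦ TangentSpace 𝓘(ℝ, E) x)]
    [IsContMDiffRiemannianBundle 𝓘(ℝ, E) ∞ E (fun x : M ↦ TangentSpace 𝓘(ℝ, E) x)]
    {F : Type*} [NormedAddCommGroup F] [NormedSpace ℝ F] [FiniteDimensional ℝ F]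
    {N : Type*} [TopologicalSpace N] [T2Space N] [ChartedSpace F N] [IsManifold 𝓘(ℝ, F) ∞ N]
    [RiemannianBundle (fun p : N ↦ TangentSpace 𝓘(ℝ, F) p)]
    [IsContMDiffRiemannianBundle 𝓘(ℝ, F) ∞ F (fun p : N ↦ TangentSpace 𝓘(ℝ, F) p)]
    (X : ∀ p : N, TangentSpace 𝓘(ℝ, F) p) (hX : Polyharmonic.IsKilling X)
    (φ : M → N) (hφ : ContMDiff 𝓘(ℝ, E) 𝓘(ℝ, F) ∞ φ) (s : ℕ) (hs : 1 ≤ s) :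
    Polyharmonic.IsSmoothVectorField (Polyharmonic.currentOdd E φ X s) ∧
      (∀ x : M, Polyharmonic.divergence (Polyharmonic.currentOdd E φ X s) x
        = -inner ℝ (Polyharmonic.tensionOdd E F φ s x) (X (φ x))) ∧
      (Polyharmonic.IsPolyharmonicOdd E F φ s →
        ∀ x : M, Polyharmonic.divergence (Polyharmonic.currentOdd E φ X s) x = 0) := by
  have h := Polyharmonic.hasDivergenceAt_currentForm (E := E) hφ hX hs
  -- `currentOdd` is by definition `sharp` of `currentForm`, so both its divergence and its
  -- smoothness come from `h`.
  have hdiv : ∀ x : M, Polyharmonic.divergence (Polyharmonic.currentOdd E φ X s) x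
      = -inner ℝ (Polyharmonic.tensionOdd E F φ s x) (X (φ x)) := fun x ↦ (h x).divergence_sharp
  refine ⟨fun x ↦ (h x).smoothForm.sharp.contMDiffAt, hdiv, fun hτ x ↦ ?_⟩
  rw [hdiv x, hτ x, inner_zero_left, neg_zero]
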